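/- **Setting.** Let $\mathcal S_2^*=\{\rho\in\mathbb C^{2\times2}:\rho\ge 0,\ \mathrm{Tr}\,\rho=1,\ \rho^2=\rho\}$ be the set of pure qubit states. In the qubit pure-state multi-armed quantum bandit (PSMAQB) with unknown environment $|\psi\rangle\langle\psi|\in\mathcal S_2^*$, at each round $t$ the learner chooses, from its past observations, a projector $\Pi_{A_t}\in\mathcal S_2^*$ and receives a reward $X_t\in\{0,1\}$ with $\Pr(X_t=1\mid\Pi_{A_t})=\langle\psi|\Pi_{A_t}|\psi\rangle$. The regret of a policy $\pi$ is $$R_T(\mathcal S_2^*,\psi,\pi)=\sum_{t=1}^T\Big(\max_{\Pi\in\mathcal S_2^*}\langle\psi|\Pi|\psi\rangle-\langle\psi|\Pi_{A_t}|\psi\rangle\Big).$$ For $a\in\mathbb S^2$ write $\Pi_a=\tfrac12(\mathbb I+a_1\sigma_x+a_2\sigma_y+a_3\sigma_z)$. **Algorithm LinUCB-VVN** in dimension $d\ge2$, with $\lambda_0>0$ and $k$ subsamples. Put $\beta_{\rm w}=9(\sqrt{9d}+\lambda_0)^2$ and $\omega(V)=\sqrt{\lambda_{\max}(V)}/(12\sqrt{d-1}\,\beta_{\rm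 w})$. Start with $V_0=\lambda_0\mathbb I$ and an arbitrary unit vector $\hat\theta_0\in\mathbb R^d$. In batch $s=1,2,\dots$: 1. let $v_1,\dots,v_d$ be an orthonormal eigenbasis of $V_{s-1}$ in non-decreasing order of eigenvalues, and let, for $i=1,\dots,d-1$, $A^\pm_{s,i}$ be the Euclidean normalization of $\hat\theta_{s-1}/\|\hat\theta_{s-1}\|_2\pm\lambda_{\min}(V_{s-1})^{-1/2}v_i$; 2. play each $A^\pm_{s,i}$ exactly $k$ times, which gives rewards $X^\pm_{s,i,j}$, $1\le j\le k$ (a batch has $2(d-1)k$ rounds, ordered by $i$, then $j$, then $+$ before $-$); 3. let $w_1=1$, $w_s=\omega(V_{s-1})$ for $s\ge2$, and put $$V_s=V_{s-1}+w_s\sum_{i=1}^{d-1}\big(A^+_{s,i}(A^+_{s,i})^{\mathsf T}+A^-_{s,i}(A^-_{s,i})^{\mathsf T}\big),\qquad \hat\theta_{s,j}=V_s^{-1}\sum_{r=1}^s w_r\sum_{i=1}^{d-1}\big(X^+_{r,i,j}A^+_{r,i}+X^-_{r,i,j}A^-_{r,i}\big);$$ 4. let $\hat\theta_s=\hat\theta_{s,j^*}$,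 where $j^*$ minimizes over $j$ the median of $\big\{\|\hat\theta_{s,j}-\hat\theta_{s,i}\|_{V_s}:i\ne j\big\}$, with $\|x\|_V=\sqrt{\langle x,Vx\rangle}$. For the qubit PSMAQB take $d=3$, $\lambda_0=2$, play the projectors $\Pi_{A^\pm_{s,i}}$, and feed the algorithm the rescaled rewards $2X-1$. **Theorem.** There are universal constants $C_1,C_2,C_3\ge0$ such that the following holds for all $\widetilde T\in\mathbb N$, every $|\psi\rangle\langle\psi|\in\mathcal S_2^*$, every initial unit vector $\hat\theta_0$ and every way of breaking ties in the choice of eigenbases and minimizers. Let $k=\lceil 24\log(\widetilde T^2)\rceil$ and run LinUCB-VVN as above for $T=\lceil 96\,\widetilde T\log(\widetilde T^2)\rceil$ rounds (the last batch may be incomplete). Then all its actions are in $\mathcal S_2^*$ and $$\mathbb E_{\psi,\pi}\big[R_T(\mathcal S_2^*,\psi,\pi)\big]\le C_1\log T+C_2\log^2T .$$ Moreover, at each step $t\in\{1,\dots,T\}$ it outputs an estimator $\hat\Pi_t\in\mathcal S_2^*$ of the unknown state, namely $\Pi_{A^\pm_{s,i}}$ for the batch $s$ to which step $t$ belongs (with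 any fixed choice of $i\in\{1,2\}$ and of the sign), such that $$\mathbb E_{\psi,\pi}\big[1-\langle\psi|\hat\Pi_t|\psi\rangle\big]\le\frac{C_3\log T}{t}.$$ (For $\widetilde T\in\{0,1\}$ one has $T=0$ and there is nothing to prove; $\log 0$ is read as $0$.) -/

import Mathlib

open scoped Matrix ComplexOrder

noncomputable section

namespace PSMAQB

/-! ## The pure state multi-armed quantum bandit -/

/-- The set of pure states (rank-one projectors) on `ℂ^d`: positive semidefinite matrices of unit
trace with `ρ² = ρ`. -/
def pureStates (d : ℕ) : Set (Matrix (Fin d) (Fin d) ℂ) :=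
  {ρ | ρ.PosSemidef ∧ ρ.trace = 1 ∧ ρ * ρ = ρ}

/-- The overlap `Tr(ρ Π)`; for `ρ = |ψ⟩⟨ψ|` it is `⟨ψ|Π|ψ⟩`, the Born probability of the
outcome `1` when the two-outcome measurement `{Π, 1 - Π}` is applied to `ρ`. -/
def overlap {d : ℕ} (ρ P : Matrix (Fin d) (Fin d) ℂ) : ℝ := (ρ * P).trace.re

/-- The distribution of the reward given the environment and the action
(`true` is the reward `1`, `false` is the reward `0`). -/
def rewardProb {d : ℕ} (ρ P : Matrix (Fin d) (Fin d) ℂ) (x : Bool) : ℝ :=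
  if x then overlap ρ P else 1 - overlap ρ P

/-- A (non-randomised) policy: the next action as a function of the rewards observed so far. The
past actions need not be listed, since they are themselves functions of the past rewards. -/
def Policy (d : ℕ) : Type := (t : ℕ) → (Fin t → Bool) → Matrix (Fin d) (Fin d) ℂ

/-- The first `t` of `T` rewards. -/
def firstRewards {T : ℕ} (x : Fin T → Bool) (t : ℕ) (ht : t ≤ T) : Fin t → Bool :=
  fun s => x (Fin.castLE ht s)

/-- The action played in a round (rounds are numbered from `0`) when the rewards are `x`. -/
def actionAt {d T : ℕ} (π : Policy d) (x : Fin T → Bool) (t : Fin T) :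
    Matrix (Fin d) (Fin d) ℂ :=
  π t (firstRewards x t t.2.le)

/-- The probability of the reward sequence `x` when `π` interacts with `ρ` for `T` rounds: the
product of the conditional reward probabilities. -/
def trajProb {d T : ℕ} (ρ : Matrix (Fin d) (Fin d) ℂ) (π : Policy d) (x : Fin T → Bool) : ℝ :=
  ∏ t : Fin T, rewardProb ρ (actionAt π x t) (x t)

/-- The expectation over `T` rounds of a function of the reward sequence. -/
def expect {d T : ℕ} (ρ : Matrix (Fin d) (Fin d) ℂ) (π : Policy d) (f : (Fin T → Bool) → ℝ) : ℝ :=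
  ∑ x : Fin T → Bool, trajProb ρ π x * f x

/-- The cumulative regret `∑ₜ (max_{Π} Tr(ρ Π) - Tr(ρ Π_{Aₜ}))` along the reward sequence `x`,
the maximum being over all rank-one projectors. -/
def regret {d T : ℕ} (ρ : Matrix (Fin d) (Fin d) ℂ) (π : Policy d) (x : Fin T → Bool) : ℝ :=
  ∑ t : Fin T, (sSup (overlap ρ '' pureStates d) - overlap ρ (actionAt π x t))

/-- The matrix `(1 + a₀ σ_x + a₁ σ_y + a₂ σ_z) / 2` with Bloch vector `a`. -/
def blochProj (a : Fin 3 → ℝ) : Matrix (Fin 2) (Fin 2) ℂ :=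
  (1 / 2 : ℂ) • (1 + (a 0 : ℂ) • !![0, 1; 1, 0] + (a 1 : ℂ) • !![0, -Complex.I; Complex.I, 0]
    + (a 2 : ℂ) • !![1, 0; 0, -1])

/-! ## The algorithm LinUCB-VVN for linear bandits on the unit sphere of `ℝ^d` -/

/-- Euclidean normalisation `a / ‖a‖₂`. -/
def normalize {d : ℕ} (a : Fin d → ℝ) : Fin d → ℝ := (√(a ⬝ᵥ a))⁻¹ • a

/-- The weighted norm `‖a‖_V = √⟨a, V a⟩`. -/
def weightedNorm {d : ℕ} (V : Matrix (Fin d) (Fin d) ℝ) (a : Fin d → ℝ) : ℝ :=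
  √(a ⬝ᵥ (V *ᵥ a))

/-- The largest eigenvalue of a symmetric matrix. -/
def lamMax {d : ℕ} (V : Matrix (Fin d) (Fin d) ℝ) : ℝ := sSup (spectrum ℝ V)

/-- The smallest eigenvalue of a symmetric matrix. -/
def lamMin {d : ℕ} (V : Matrix (Fin d) (Fin d) ℝ) : ℝ := sInf (spectrum ℝ V)

/-- The median of a finite family of reals (mean of the two middle values if their number is
even). -/
def median (s : Multiset ℝ) : ℝ :=
  let l := s.sort (· ≤ ·)
  (l.getD ((l.length - 1) / 2) 0 + l.getD (l.length / 2) 0) / 2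

/-- `v` is an orthonormal basis of eigenvectors of `V`, in non-decreasing order of eigenvalues. -/
def IsOrderedEigenbasis {d : ℕ} (V : Matrix (Fin d) (Fin d) ℝ) (v : Fin d → Fin d → ℝ) : Prop :=
  (∀ i j, v i ⬝ᵥ v j = if i = j then 1 else 0) ∧
    ∃ l : Fin d → ℝ, Monotone l ∧ ∀ i, V *ᵥ v i = l i • v i

/-- The choices that the pseudo-code leaves open: which ordered eigenbasis of a symmetric matrix
is used, and which index is returned when a minimum over `k > 0` indices is attained several
times. -/
structure TieBreak (d : ℕ) where
  eigvec : Matrix (Fin d) (Fin d) ℝ → Fin d → Fin d → ℝ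
  eigvec_spec : ∀ V : Matrix (Fin d) (Fin d) ℝ, V.IsSymm → IsOrderedEigenbasis V (eigvec V)
  argmin : (k : ℕ) → 0 < k → (Fin k → ℝ) → Fin k
  argmin_spec : ∀ (k : ℕ) (hk : 0 < k) (y : Fin k → ℝ) (j : Fin k), y (argmin k hk y) ≤ y j

theorem exists_isOrderedEigenbasis {d : ℕ} (V : Matrix (Fin d) (Fin d) ℝ) (hV : V.IsSymm) :
    ∃ v, IsOrderedEigenbasis V v := by
  have hH : V.IsHermitian := by
    unfold Matrix.IsHermitian
    rw [Matrix.conjTranspose_eq_transpose_of_trivial]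
    exact hV
  let e := Tuple.sort hH.eigenvalues
  refine ⟨fun i => (hH.eigenvectorBasis (e i)).ofLp, fun i j => ?_,
    hH.eigenvalues ∘ e, Tuple.monotone_sort _, fun i => hH.mulVec_eigenvectorBasis (e i)⟩
  have h := orthonormal_iff_ite.mp hH.eigenvectorBasis.orthonormal (e j) (e i)
  rw [EuclideanSpace.inner_eq_star_dotProduct] at h
  simpa [eq_comm] using h

instance (d : ℕ) : Nonempty (TieBreak d) := by
  choose! v hv using fun (V : Matrix (Fin d) (Fin d) ℝ) => exists_isOrderedEigenbasis V
  have h : ∀ (k : ℕ) (_ : 0 < k) (y : Fin k → ℝ), ∃ i, ∀ j, y i ≤ y j := fun k hk y =>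
    haveI : Nonempty (Fin k) := ⟨⟨0, hk⟩⟩
    Finite.exists_min y
  choose a ha using h
  exact ⟨⟨v, hv, a, ha⟩⟩

/-- What the algorithm stores after a number of completed batches. -/
structure State (d k : ℕ) where
  /-- the weighted design matrix `V` -/
  design : Matrix (Fin d) (Fin d) ℝ
  /-- for each subsample `j`, the weighted sum `∑ₛ σ̂ₛ⁻² ∑ᵢ (X⁺ A⁺ + X⁻ A⁻)` -/
  response : Fin k → Fin d → ℝ
  /-- the current estimator of `θ` (median of means, or the initial vector) -/
  est : Fin d → ℝ

/-- The action `A^±_i` of the next batch (`sgn = true` for `+`):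
the normalisation of `θ̂ / ‖θ̂‖ ± λ_min(V)^{-1/2} v_i`. -/
def nextAction {d k : ℕ} (tb : TieBreak d) (S : State d k) (i : Fin (d - 1)) (sgn : Bool) :
    Fin d → ℝ :=
  normalize (normalize S.est + ((if sgn then 1 else -1) * (√(lamMin S.design))⁻¹) •
    tb.eigvec S.design (Fin.castLE (Nat.sub_le d 1) i))

/-- The weighted least squares estimator `V⁻¹ ∑ …` of the subsample `j`. -/
def lse {d k : ℕ} (V : Matrix (Fin d) (Fin d) ℝ) (b : Fin k → Fin d → ℝ) (j : Fin k) :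
    Fin d → ℝ := V⁻¹ *ᵥ b j

/-- `y_j`: the median of the `V`-distances of the `j`-th estimator to the other ones. -/
def medianDist {d k : ℕ} (V : Matrix (Fin d) (Fin d) ℝ) (b : Fin k → Fin d → ℝ) (j : Fin k) : ℝ :=
  median ((Finset.univ.erase j).val.map fun i => weightedNorm V (lse V b j - lse V b i))

/-- One batch: `w = σ̂⁻²` is the weight of the batch, `X i sgn j` the `j`-th reward of the action
`A^sgn_i`. -/
def State.next {d k : ℕ} (tb : TieBreak d) (w : ℝ) (X : Fin (d - 1) → Bool → Fin k → ℝ)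
    (S : State d k) : State d k :=
  let A := nextAction tb S
  let V := S.design + w • ∑ i, (Matrix.vecMulVec (A i true) (A i true)
    + Matrix.vecMulVec (A i false) (A i false))
  let b : Fin k → Fin d → ℝ := fun j =>
    S.response j + w • ∑ i, (X i true j • A i true + X i false j • A i false)
  { design := V
    response := b
    est := if hk : 0 < k then lse V b (tb.argmin k hk (medianDist V b)) else S.est }

/-- The number of rounds of a batch: `k` for each of the `2(d-1)` actions. -/
def batchLength (d k : ℕ) : ℕ := 2 * (d - 1) * k

/-- The round (numbered from `0`) in which the `j`-th reward of the action `A^sgn_i` of the batch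
`s` (numbered from `0`) is received; the loop over `i` is the outer one, the loop over `j` the
inner one, and `X⁺` comes before `X⁻`. -/
def roundOf (d k s : ℕ) (i : Fin (d - 1)) (sgn : Bool) (j : Fin k) : ℕ :=
  s * batchLength d k + (2 * k * i + 2 * j + if sgn then 0 else 1)

/-- The state after the given number of batches, when `X t` is the reward received in round `t`.
The weight is `1` in the first batch and `ω(V)` afterwards. -/
def run {d : ℕ} (tb : TieBreak d) (lam0 : ℝ) (k : ℕ) (ω : Matrix (Fin d) (Fin d) ℝ → ℝ)
    (init : Fin d → ℝ) (X : ℕ → ℝ) : ℕ → State d k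
  | 0 => { design := lam0 • 1, response := 0, est := init }
  | s + 1 =>
    let S := run tb lam0 k ω init X s
    S.next tb (if s = 0 then 1 else ω S.design) fun i sgn j => X (roundOf d k s i sgn j)

/-- The index `i` of the action that is played in round `t`. -/
def actionIndex {d : ℕ} (hd : 2 ≤ d) (k t : ℕ) : Fin (d - 1) :=
  ⟨t % batchLength d k / (2 * k), by
    rcases Nat.eq_zero_or_pos k with rfl | hk
    · simp; omega
    · apply Nat.div_lt_of_lt_mul
      calc t % batchLength d k < batchLength d k :=
            Nat.mod_lt _ (Nat.mul_pos (by omega) hk)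
        _ = 2 * k * (d - 1) := by unfold batchLength; ring⟩

/-- The action of LinUCB-VVN in round `t`, given the rewards of the earlier rounds. -/
def linUCBAction {d : ℕ} (hd : 2 ≤ d) (tb : TieBreak d) (lam0 : ℝ) (k : ℕ)
    (ω : Matrix (Fin d) (Fin d) ℝ → ℝ) (init : Fin d → ℝ) (X : ℕ → ℝ) (t : ℕ) : Fin d → ℝ :=
  nextAction tb (run tb lam0 k ω init X (t / batchLength d k)) (actionIndex hd k t)
    (decide (t % 2 = 0))

/-- The constant `β_w = 9 (√(9d) + λ₀ ‖θ‖)²` for `‖θ‖ = 1`. -/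
def betaW (d : ℕ) (lam0 : ℝ) : ℝ := 9 * (√(9 * d) + lam0) ^ 2

/-- The weight function `ω(V) = √(λ_max(V)) / (12 √(d-1) β_w)`. -/
def weight (d : ℕ) (lam0 : ℝ) (V : Matrix (Fin d) (Fin d) ℝ) : ℝ :=
  √(lamMax V) / (12 * √((d : ℝ) - 1) * betaW d lam0)

/-! ## LinUCB-VVN for the qubit bandit -/

/-- The rescaled rewards `2X - 1 ∈ {-1, 1}` fed to the linear bandit algorithm (only the entries
of rounds already played are ever read). -/
def rescaled {t : ℕ} (h : Fin t → Bool) (n : ℕ) : ℝ :=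
  if hn : n < t then 2 * (if h ⟨n, hn⟩ then 1 else 0) - 1 else 0

/-- LinUCB-VVN for `d = 3` with `λ₀ = 2`, played on the Bloch sphere. -/
def qubitPolicy (tb : TieBreak 3) (k : ℕ) (init : Fin 3 → ℝ) : Policy 2 := fun t h =>
  blochProj (linUCBAction (by norm_num) tb 2 k (weight 3 2) init (rescaled h) t)

/-- The estimator of the unknown state that is output at the end of step `t ≥ 1` (steps are
numbered from `1`) from the first `t` rewards: the projector whose Bloch vector is the action
`A^sgn_i` of the batch to which step `t` belongs. -/
def qubitEstimator (tb : TieBreak 3) (k : ℕ) (init : Fin 3 → ℝ) (i : Fin 2) (sgn : Bool)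
    (t : ℕ) (h : Fin t → Bool) : Matrix (Fin 2) (Fin 2) ℂ :=
  blochProj (nextAction tb
    (run tb 2 k (weight 3 2) init (rescaled h) ((t - 1) / batchLength 3 k)) i sgn)

/-- The number of subsamples `k = ⌈24 log(N²)⌉` for `N` batches. -/
def subsamples (N : ℕ) : ℕ := ⌈24 * Real.log ((N : ℝ) ^ 2)⌉₊

/-- The time horizon `T = ⌈96 N log(N²)⌉` for `N` batches. -/
def horizon (N : ℕ) : ℕ := ⌈96 * (N : ℝ) * Real.log ((N : ℝ) ^ 2)⌉₊

end PSMAQB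

end

/-! On the Bloch sphere a pure state is a unit vector `θ`, the rescaled reward of the action `A` has
mean `⟨θ, A⟩` and variance `1 - ⟨θ, A⟩²`, and the infidelity is `(1 - ⟨θ, A⟩) / 2`. Good actions are
thus nearly noiseless, so weights can grow while the actions approach `θ`.

Deterministic part. Write `C` for `weightConst`, so that `ω(V) = C √λ_max(V)`. A batch of weight `w`
adds `4w` to the trace, at most `4w` to `λ_max`, and at least `2w / (3 λ_min)` in each of the two
lowest eigendirections. This preserves `λ_max ≤ 3 λ_min²`, while the trace stays above `(2 + C s)²`
after `s` batches (`designBounds_next`). Hence `λ_min` grows at least linearly in `s`. If the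
estimate satisfies `‖θ̂ - θ‖_V² ≤ β_w`, the next actions have infidelity `O(1 / λ_min)`, and the
same bound makes `ω(V)` times their reward variance at most `1` (`weight_mul_variance_le`).

Probabilistic part. The design is adaptive and shared by all subsamples, so these are not
independent. For a fixed `P ≥ 0`, let `Q_j` be the squared `P`-norm of the weighted noise of the
subsample `j`, and let `B_j` be the sum of `w ⟨A, P A⟩` over its rounds. As long as the weights are
valid, `Q_j - B_j` is a supermartingale. A round changes only one subsample, so the product over `j`
of `1 + (Q_j + 16/5 - B_j) / 4`, killed when the budget `16/5` or the validity of the weights is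
violated, is again a supermartingale (`sum_potential_succ_le`). It starts at no more than `(9/5) ^
k`. About half of the subsamples being noisy forces it above `3 ^ (k - 1)`, so Markov's inequality
gives failure probability at most `3 (3/5) ^ k`. The relevant `P = V⁻¹` is random; it is replaced by
an element of a net of polynomial size (`gridInverse_spec`), and a union bound over the net and over
the first bad batch costs a power of `N` (`expect_failure_le`), which `k ≥ 48 log N` more than
absorbs.

Without failure the actions of the batch `s` have infidelity `O(1 / (s + 1))`. Batches have length
`4k = O(log T)`, so round `t` has infidelity `O(log T / t)`, which sums to `O(log² T)`. The failure
event has probability `O(1 / N)` and contributes `O(T / N) = O(log T)` to the regret. -/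

open scoped Matrix ComplexOrder

namespace PSMAQB

/-! ### Quadratic forms of symmetric matrices -/

section QuadraticForms

variable {d : ℕ}

/-- `V` is symmetric and `V ≥ c` as a quadratic form. -/
structure IsBddBelow (c : ℝ) (V : Matrix (Fin d) (Fin d) ℝ) : Prop where
  symm : V.IsSymm
  le : ∀ x : Fin d → ℝ, c * (x ⬝ᵥ x) ≤ x ⬝ᵥ (V *ᵥ x)

theorem dotProduct_self_nonneg' (x : Fin d → ℝ) : 0 ≤ x ⬝ᵥ x := by
  simpa using dotProduct_star_self_nonneg x

theorem dotProduct_mulVec_comm {V : Matrix (Fin d) (Fin d) ℝ} (hV : V.IsSymm) (x y : Fin d → ℝ) :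
    x ⬝ᵥ (V *ᵥ y) = y ⬝ᵥ (V *ᵥ x) := by
  rw [Matrix.dotProduct_mulVec, ← Matrix.mulVec_transpose, hV.eq, dotProduct_comm]

theorem IsBddBelow.posSemidef {c : ℝ} (hc : 0 ≤ c) {V : Matrix (Fin d) (Fin d) ℝ}
    (hV : IsBddBelow c V) : V.PosSemidef := by
  refine Matrix.PosSemidef.of_dotProduct_mulVec_nonneg ?_ fun x => ?_
  · rw [Matrix.IsHermitian, Matrix.conjTranspose_eq_transpose_of_trivial]; exact hV.symm
  · simpa using (mul_nonneg hc (dotProduct_self_nonneg' x)).trans (hV.le x)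

theorem IsBddBelow.posDef {c : ℝ} (hc : 0 < c) {V : Matrix (Fin d) (Fin d) ℝ}
    (hV : IsBddBelow c V) : V.PosDef := by
  refine Matrix.PosDef.of_dotProduct_mulVec_pos ?_ fun x hx => ?_
  · rw [Matrix.IsHermitian, Matrix.conjTranspose_eq_transpose_of_trivial]; exact hV.symm
  · have h : 0 < x ⬝ᵥ x := by simpa using Matrix.dotProduct_star_self_pos_iff.mpr hx
    simpa using (mul_pos hc h).trans_le (hV.le x)

theorem posSemidef_isSymm {V : Matrix (Fin d) (Fin d) ℝ} (hV : V.PosSemidef) : V.IsSymm := by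
  have h := hV.isHermitian
  rwa [Matrix.IsHermitian, Matrix.conjTranspose_eq_transpose_of_trivial] at h

theorem posSemidef_form_nonneg {V : Matrix (Fin d) (Fin d) ℝ} (hV : V.PosSemidef)
    (x : Fin d → ℝ) : 0 ≤ x ⬝ᵥ (V *ᵥ x) := by
  simpa using hV.dotProduct_mulVec_nonneg x

open scoped MatrixOrder Matrix.Norms.L2Operator in
theorem exists_eq_transpose_mul_self {V : Matrix (Fin d) (Fin d) ℝ} (hV : V.PosSemidef) :
    ∃ B : Matrix (Fin d) (Fin d) ℝ, V = Bᵀ * B := by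
  obtain ⟨B, hB⟩ := CStarAlgebra.nonneg_iff_eq_star_mul_self.mp hV.nonneg
  rw [Matrix.star_eq_conjTranspose, Matrix.conjTranspose_eq_transpose_of_trivial] at hB
  exact ⟨B, hB⟩

theorem exists_form_eq_normSq {V : Matrix (Fin d) (Fin d) ℝ} (hV : V.PosSemidef) :
    ∃ B : Matrix (Fin d) (Fin d) ℝ, V = Bᵀ * B ∧
      ∀ x y : Fin d → ℝ, x ⬝ᵥ (V *ᵥ y) = (B *ᵥ x) ⬝ᵥ (B *ᵥ y) := by
  obtain ⟨B, hB⟩ := exists_eq_transpose_mul_self hV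
  refine ⟨B, hB, fun x y => ?_⟩
  rw [hB, ← Matrix.mulVec_mulVec, Matrix.dotProduct_mulVec, Matrix.vecMul_transpose]

theorem sqrt_dotProduct_self (x : Fin d → ℝ) : √(x ⬝ᵥ x) = ‖WithLp.toLp 2 x‖ := by
  rw [EuclideanSpace.norm_eq]
  simp [dotProduct, sq]

theorem form_cauchy_schwarz {V : Matrix (Fin d) (Fin d) ℝ} (hV : V.PosSemidef)
    (x y : Fin d → ℝ) : (x ⬝ᵥ (V *ᵥ y)) ^ 2 ≤ (x ⬝ᵥ (V *ᵥ x)) * (y ⬝ᵥ (V *ᵥ y)) := by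
  obtain ⟨B, -, hB⟩ := exists_form_eq_normSq hV
  rw [hB, hB, hB]
  simpa [dotProduct, sq] using
    Finset.sum_mul_sq_le_sq_mul_sq Finset.univ (B *ᵥ x) (B *ᵥ y)

theorem weightedNorm_add_le {V : Matrix (Fin d) (Fin d) ℝ} (hV : V.PosSemidef)
    (x y : Fin d → ℝ) : weightedNorm V (x + y) ≤ weightedNorm V x + weightedNorm V y := by
  obtain ⟨B, -, hB⟩ := exists_form_eq_normSq hV
  simp only [weightedNorm, hB, sqrt_dotProduct_self]
  rw [Matrix.mulVec_add]
  exact norm_add_le (WithLp.toLp 2 (B *ᵥ x)) (WithLp.toLp 2 (B *ᵥ y))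

theorem weightedNorm_neg (V : Matrix (Fin d) (Fin d) ℝ) (x : Fin d → ℝ) :
    weightedNorm V (-x) = weightedNorm V x := by
  simp [weightedNorm, Matrix.mulVec_neg]

theorem weightedNorm_sub_comm (V : Matrix (Fin d) (Fin d) ℝ) (x y : Fin d → ℝ) :
    weightedNorm V (x - y) = weightedNorm V (y - x) := by
  rw [← weightedNorm_neg, neg_sub]

theorem weightedNorm_sub_le {V : Matrix (Fin d) (Fin d) ℝ} (hV : V.PosSemidef)
    (x y z : Fin d → ℝ) : weightedNorm V (x - z) ≤ weightedNorm V (x - y) + weightedNorm V (y - z) := by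
  have h := weightedNorm_add_le hV (x - y) (y - z)
  rwa [sub_add_sub_cancel] at h

/-- With `M = BᵀB`, cyclicity turns the trace into that of the positive semidefinite matrix `B P
Bᵀ`. -/
theorem trace_mul_nonneg {P M : Matrix (Fin d) (Fin d) ℝ} (hP : P.PosSemidef)
    (hM : M.PosSemidef) : 0 ≤ (P * M).trace := by
  obtain ⟨B, rfl⟩ := exists_eq_transpose_mul_self hM
  rw [← mul_assoc, Matrix.trace_mul_comm, ← mul_assoc]
  simpa [Matrix.conjTranspose_eq_transpose_of_trivial] using
    (hP.mul_mul_conjTranspose_same B).trace_nonneg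

theorem trace_mul_vecMulVec (P : Matrix (Fin d) (Fin d) ℝ) (a : Fin d → ℝ) :
    (P * Matrix.vecMulVec a a).trace = a ⬝ᵥ (P *ᵥ a) := by
  rw [Matrix.mul_vecMulVec, Matrix.trace_vecMulVec, dotProduct_comm]

/-- If `V ≤ c W` then `Tr (W⁻¹ V) ≤ c d`. -/
theorem trace_inv_mul_le {c : ℝ} {V W : Matrix (Fin d) (Fin d) ℝ} (hV : V.IsSymm) (hW : W.PosDef)
    (h : ∀ x : Fin d → ℝ, x ⬝ᵥ (V *ᵥ x) ≤ c * (x ⬝ᵥ (W *ᵥ x))) :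
    (W⁻¹ * V).trace ≤ c * d := by
  have hM : (c • W - V).PosSemidef := by
    refine IsBddBelow.posSemidef le_rfl ⟨?_, fun x => ?_⟩
    · rw [Matrix.IsSymm, Matrix.transpose_sub, Matrix.transpose_smul, hV.eq,
        (posSemidef_isSymm hW.posSemidef).eq]
    · simpa [Matrix.sub_mulVec, Matrix.smul_mulVec, dotProduct_sub] using h x
  have h0 := trace_mul_nonneg hW.inv.posSemidef hM
  have hu : IsUnit W.det := (Matrix.isUnit_iff_isUnit_det W).mp hW.isUnit
  rw [Matrix.mul_sub, Matrix.mul_smul, Matrix.nonsing_inv_mul _ hu, Matrix.trace_sub,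
    Matrix.trace_smul, Matrix.trace_one, Fintype.card_fin, smul_eq_mul] at h0
  linarith

/-- Inversion is antitone: if `W ≤ c V` then `V⁻¹ ≤ c W⁻¹`. -/
theorem form_inv_le {c : ℝ} {V W : Matrix (Fin d) (Fin d) ℝ} (hV : V.PosDef) (hW : W.PosDef)
    (h : ∀ x : Fin d → ℝ, x ⬝ᵥ (W *ᵥ x) ≤ c * (x ⬝ᵥ (V *ᵥ x))) (x : Fin d → ℝ) :
    x ⬝ᵥ (V⁻¹ *ᵥ x) ≤ c * (x ⬝ᵥ (W⁻¹ *ᵥ x)) := by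
  have huV : IsUnit V.det := (Matrix.isUnit_iff_isUnit_det V).mp hV.isUnit
  have huW : IsUnit W.det := (Matrix.isUnit_iff_isUnit_det W).mp hW.isUnit
  set y := V⁻¹ *ᵥ x with hy
  set z := W⁻¹ *ᵥ x with hz
  have hVy : V *ᵥ y = x := by rw [hy, Matrix.mulVec_mulVec, Matrix.mul_nonsing_inv _ huV,
    Matrix.one_mulVec]
  have hWz : W *ᵥ z = x := by rw [hz, Matrix.mulVec_mulVec, Matrix.mul_nonsing_inv _ huW,
    Matrix.one_mulVec]
  -- Since `⟨y, W z⟩ = ⟨x, y⟩`, this gives `⟨x, y⟩² ≤ ⟨y, W y⟩ ⟨x, z⟩ ≤ c ⟨x, y⟩ ⟨x, z⟩`; it remains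
  -- to cancel `⟨x, y⟩`.
  have h1 := form_cauchy_schwarz hW.posSemidef y z
  rw [hWz, dotProduct_comm y x, dotProduct_comm z x] at h1
  have h2 := h y
  rw [hVy, dotProduct_comm y x] at h2
  have hz0 : 0 ≤ x ⬝ᵥ z := posSemidef_form_nonneg hW.inv.posSemidef x
  have hy0 : 0 ≤ x ⬝ᵥ y := posSemidef_form_nonneg hV.inv.posSemidef x
  rcases hy0.eq_or_lt with h0 | h0
  · rw [← h0] at h2 ⊢
    by_cases hx : x = 0
    · simp [hx]
    · have := hV.inv.dotProduct_mulVec_pos hx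
      rw [star_trivial] at this
      exact absurd h0 (ne_of_lt this)
  · have h3 : (x ⬝ᵥ y) * (x ⬝ᵥ y) ≤ (c * (x ⬝ᵥ z)) * (x ⬝ᵥ y) := by
      nlinarith [mul_le_mul_of_nonneg_right h2 hz0]
    exact le_of_mul_le_mul_right h3 h0

/-- Two matrices above `2` whose entries differ by at most `ε` are comparable. -/
theorem form_le_of_entries_close {ε : ℝ} (hε : 0 ≤ ε) {V W : Matrix (Fin d) (Fin d) ℝ}
    (hW : IsBddBelow 2 W) (h : ∀ i j, |V i j - W i j| ≤ ε) (x : Fin d → ℝ) :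
    x ⬝ᵥ (V *ᵥ x) ≤ (1 + ε * d / 2) * (x ⬝ᵥ (W *ᵥ x)) := by
  have h1 : x ⬝ᵥ ((V - W) *ᵥ x) ≤ ε * (∑ i, |x i|) ^ 2 := by
    rw [sq, Finset.sum_mul_sum, Finset.mul_sum]
    simp only [dotProduct, Matrix.mulVec, Finset.mul_sum]
    refine Finset.sum_le_sum fun i _ => Finset.sum_le_sum fun j _ => ?_
    calc x i * ((V - W) i j * x j) ≤ |x i * ((V - W) i j * x j)| := le_abs_self _
      _ = |V i j - W i j| * (|x i| * |x j|) := by rw [abs_mul, abs_mul, Matrix.sub_apply]; ring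
      _ ≤ _ := mul_le_mul_of_nonneg_right (h i j) (by positivity)
  have h2 : (∑ i, |x i|) ^ 2 ≤ d * (x ⬝ᵥ x) := by
    have := sq_sum_le_card_mul_sum_sq (s := Finset.univ) (f := fun i => |x i|)
    simpa [dotProduct, sq] using this
  have h3 := hW.le x
  rw [Matrix.sub_mulVec, dotProduct_sub] at h1
  have h4 : ε * (∑ i, |x i|) ^ 2 ≤ ε * d / 2 * (x ⬝ᵥ (W *ᵥ x)) := by
    calc ε * (∑ i, |x i|) ^ 2 ≤ ε * (d * (x ⬝ᵥ x)) := by gcongr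
      _ = ε * d / 2 * (2 * (x ⬝ᵥ x)) := by ring
      _ ≤ _ := by gcongr
  linarith

end QuadraticForms

/-! ### Ordered eigenbases and extreme eigenvalues -/

section Eigenbases

variable {d : ℕ} {V : Matrix (Fin d) (Fin d) ℝ} {v : Fin d → Fin d → ℝ}

theorem orthonormal_expansion (hv : ∀ i j, v i ⬝ᵥ v j = if i = j then 1 else 0) (x : Fin d → ℝ) :
    x = ∑ i, (v i ⬝ᵥ x) • v i := by
  have h1 : Matrix.of v * (Matrix.of v)ᵀ = 1 := by
    ext i j
    rw [Matrix.mul_apply, Matrix.one_apply, ← hv i j]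
    rfl
  have h2 : (Matrix.of v)ᵀ * Matrix.of v = 1 := mul_eq_one_comm.mp h1
  have h3 : (Matrix.of v)ᵀ *ᵥ (Matrix.of v *ᵥ x) = x := by
    rw [Matrix.mulVec_mulVec, h2, Matrix.one_mulVec]
  conv_lhs => rw [← h3]
  ext a
  simp only [Matrix.mulVec, dotProduct, Matrix.transpose_apply, Matrix.of_apply,
    Finset.sum_apply, Pi.smul_apply, smul_eq_mul]
  exact Finset.sum_congr rfl fun i _ => mul_comm _ _

theorem dotProduct_eq_sum_coords (hv : ∀ i j, v i ⬝ᵥ v j = if i = j then 1 else 0)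
    (x y : Fin d → ℝ) : x ⬝ᵥ y = ∑ i, (v i ⬝ᵥ x) * (v i ⬝ᵥ y) := by
  conv_lhs => rw [orthonormal_expansion hv x]
  simp [sum_dotProduct, smul_dotProduct]

theorem form_eq_sum_eigenvalues (hV : V.IsSymm)
    (hv : ∀ i j, v i ⬝ᵥ v j = if i = j then 1 else 0)
    {l : Fin d → ℝ} (hl : ∀ i, V *ᵥ v i = l i • v i) (x : Fin d → ℝ) :
    x ⬝ᵥ (V *ᵥ x) = ∑ i, l i * (v i ⬝ᵥ x) ^ 2 := by
  rw [dotProduct_eq_sum_coords hv]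
  refine Finset.sum_congr rfl fun i _ => ?_
  rw [dotProduct_mulVec_comm hV, hl, dotProduct_smul, smul_eq_mul, dotProduct_comm x]
  ring

/-- Symmetry gives `(μ - l i) ⟨v i, x⟩ = 0` for an eigenvector `x` with eigenvalue `μ`, and some
coordinate of `x` is nonzero. This links `lamMin` and `lamMax`, defined through the spectrum, to the
eigenbasis used by the algorithm. -/
theorem spectrum_eq_range (hV : V.IsSymm)
    (hv : ∀ i j, v i ⬝ᵥ v j = if i = j then 1 else 0)
    {l : Fin d → ℝ} (hl : ∀ i, V *ᵥ v i = l i • v i) : spectrum ℝ V = Set.range l := by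
  ext μ
  rw [← Matrix.spectrum_toLin', ← Module.End.hasEigenvalue_iff_mem_spectrum]
  constructor
  · intro h
    obtain ⟨x, hx, hx0⟩ := h.exists_hasEigenvector
    rw [Module.End.mem_eigenspace_iff, Matrix.toLin'_apply] at hx
    by_contra hμ
    refine hx0 ?_
    rw [orthonormal_expansion hv x]
    refine Finset.sum_eq_zero fun i _ => ?_
    have h1 : v i ⬝ᵥ (V *ᵥ x) = l i * (v i ⬝ᵥ x) := by
      rw [dotProduct_mulVec_comm hV, hl, dotProduct_smul, smul_eq_mul, dotProduct_comm x]
    rw [hx, dotProduct_smul, smul_eq_mul] at h1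
    have h2 : (μ - l i) * (v i ⬝ᵥ x) = 0 := by linarith
    rcases mul_eq_zero.mp h2 with h3 | h3
    · exact absurd ⟨i, by linarith⟩ hμ
    · rw [h3, zero_smul]
  · rintro ⟨i, rfl⟩
    refine Module.End.hasEigenvalue_of_hasEigenvector (x := v i) ⟨?_, fun h0 => ?_⟩
    · rw [Module.End.mem_eigenspace_iff, Matrix.toLin'_apply, hl]
    · have := hv i i
      simp [h0] at this

end Eigenbases

section ExtremeEigenvalues

variable {n : ℕ} {V : Matrix (Fin (n + 1)) (Fin (n + 1)) ℝ}

theorem IsOrderedEigenbasis.exists_eigenvalues (hV : V.IsSymm)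
    {v : Fin (n + 1) → Fin (n + 1) → ℝ} (hv : IsOrderedEigenbasis V v) :
    ∃ l : Fin (n + 1) → ℝ, Monotone l ∧ l 0 = lamMin V ∧ l (Fin.last n) = lamMax V ∧
      ∀ x, x ⬝ᵥ (V *ᵥ x) = ∑ i, l i * (v i ⬝ᵥ x) ^ 2 := by
  obtain ⟨ho, l, hmono, hl⟩ := hv
  have hs := spectrum_eq_range hV ho hl
  refine ⟨l, hmono, ?_, ?_, form_eq_sum_eigenvalues hV ho hl⟩
  · rw [lamMin, hs]
    have h : IsLeast (Set.range l) (l 0) := ⟨⟨0, rfl⟩, ?_⟩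
    · exact h.csInf_eq.symm
    rintro _ ⟨i, rfl⟩
    exact hmono (Fin.zero_le i)
  · rw [lamMax, hs]
    have h : IsGreatest (Set.range l) (l (Fin.last n)) := ⟨⟨Fin.last n, rfl⟩, ?_⟩
    · exact h.csSup_eq.symm
    rintro _ ⟨i, rfl⟩
    exact hmono (Fin.le_last i)

theorem lamMin_mul_le (hV : V.IsSymm) (x : Fin (n + 1) → ℝ) :
    lamMin V * (x ⬝ᵥ x) ≤ x ⬝ᵥ (V *ᵥ x) := by
  obtain ⟨v, hv⟩ := exists_isOrderedEigenbasis V hV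
  obtain ⟨l, hmono, h0, -, hf⟩ := hv.exists_eigenvalues hV
  rw [hf, dotProduct_eq_sum_coords hv.1, Finset.mul_sum, ← h0]
  refine Finset.sum_le_sum fun i _ => ?_
  rw [← sq]
  exact mul_le_mul_of_nonneg_right (hmono (Fin.zero_le i)) (sq_nonneg _)

theorem le_lamMax_mul (hV : V.IsSymm) (x : Fin (n + 1) → ℝ) :
    x ⬝ᵥ (V *ᵥ x) ≤ lamMax V * (x ⬝ᵥ x) := by
  obtain ⟨v, hv⟩ := exists_isOrderedEigenbasis V hV
  obtain ⟨l, hmono, -, h1, hf⟩ := hv.exists_eigenvalues hV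
  rw [hf, dotProduct_eq_sum_coords hv.1, Finset.mul_sum, ← h1]
  refine Finset.sum_le_sum fun i _ => ?_
  rw [← sq]
  exact mul_le_mul_of_nonneg_right (hmono (Fin.le_last i)) (sq_nonneg _)

theorem le_lamMin {c : ℝ} (hV : IsBddBelow c V) : c ≤ lamMin V := by
  obtain ⟨v, hv⟩ := exists_isOrderedEigenbasis V hV.symm
  obtain ⟨l, -, h0, -, hf⟩ := hv.exists_eigenvalues hV.symm
  have h := hV.le (v 0)
  rw [hf, hv.1] at h
  simpa [hv.1, h0] using h

theorem lamMax_le {c : ℝ} (hV : V.IsSymm)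
    (h : ∀ x : Fin (n + 1) → ℝ, x ⬝ᵥ (V *ᵥ x) ≤ c * (x ⬝ᵥ x)) : lamMax V ≤ c := by
  obtain ⟨v, hv⟩ := exists_isOrderedEigenbasis V hV
  obtain ⟨l, -, -, h1, hf⟩ := hv.exists_eigenvalues hV
  have h := h (v (Fin.last n))
  rw [hf, hv.1] at h
  simpa [hv.1, h1] using h

theorem lamMin_le_lamMax (hV : V.IsSymm) : lamMin V ≤ lamMax V := by
  obtain ⟨v, hv⟩ := exists_isOrderedEigenbasis V hV
  obtain ⟨l, hmono, h0, h1, -⟩ := hv.exists_eigenvalues hV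
  rw [← h0, ← h1]
  exact hmono (Fin.zero_le _)

theorem diag_eq_form {d : ℕ} (V : Matrix (Fin d) (Fin d) ℝ) (i : Fin d) :
    V i i = Pi.single i 1 ⬝ᵥ (V *ᵥ Pi.single i 1) := by
  simp

theorem diag_le_lamMax (hV : V.IsSymm) (i : Fin (n + 1)) : V i i ≤ lamMax V := by
  have h := le_lamMax_mul hV (Pi.single i 1)
  rw [← diag_eq_form] at h
  simpa using h

theorem trace_le_lamMax (hV : V.IsSymm) : V.trace ≤ (n + 1) * lamMax V := by
  rw [Matrix.trace]
  calc ∑ i, V.diag i ≤ ∑ _i : Fin (n + 1), lamMax V :=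
        Finset.sum_le_sum fun i _ => diag_le_lamMax hV i
    _ = _ := by simp

/-- Cauchy–Schwarz for the form of `V` bounds an entry by the diagonal ones. It confines the design
matrices to a bounded box, which makes the net finite. -/
theorem abs_entry_le_lamMax {c : ℝ} (hc : 0 ≤ c) (hV : IsBddBelow c V) (i j : Fin (n + 1)) :
    |V i j| ≤ lamMax V := by
  have hp := hV.posSemidef hc
  have h := form_cauchy_schwarz hp (Pi.single i 1) (Pi.single j 1)
  rw [← diag_eq_form, ← diag_eq_form] at h
  have hi : 0 ≤ V i i := hp.diag_nonneg
  have hj : 0 ≤ V j j := hp.diag_nonneg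
  have h1 := diag_le_lamMax hV.symm i
  have h2 := diag_le_lamMax hV.symm j
  refine abs_le_of_sq_le_sq ?_ (hi.trans h1)
  calc V i j ^ 2 ≤ V i i * V j j := by simpa using h
    _ ≤ lamMax V ^ 2 := by rw [sq]; exact mul_le_mul h1 h2 hj (hi.trans h1)

end ExtremeEigenvalues

/-! ### Medians and the median-of-means estimator -/

section Median

/-- In a sorted list the entries at most `c` form an initial segment. This and its converse below
turn statements about medians into counts. -/
theorem getD_le_of_lt_countP {c : ℝ} {l : List ℝ} (hl : l.Pairwise (· ≤ ·)) {m : ℕ}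
    (h : m < l.countP (· ≤ c)) : l.getD m 0 ≤ c := by
  induction l generalizing m with
  | nil => simp at h
  | cons a t ih =>
    rw [List.pairwise_cons] at hl
    cases m with
    | zero =>
      obtain ⟨b, hb, hbc⟩ := List.countP_pos_iff.mp h
      have hbc : b ≤ c := by simpa using hbc
      rcases List.mem_cons.mp hb with rfl | hb
      · simpa using hbc
      · simpa using (hl.1 b hb).trans hbc
    | succ m =>
      rw [List.getD_cons_succ]
      refine ih hl.2 ?_
      rw [List.countP_cons] at h
      split_ifs at h <;> omega

theorem lt_countP_of_getD_le {c : ℝ} {l : List ℝ} (hl : l.Pairwise (· ≤ ·)) {m : ℕ}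
    (hm : m < l.length) (h : l.getD m 0 ≤ c) : m < l.countP (· ≤ c) := by
  induction l generalizing m with
  | nil => simp at hm
  | cons a t ih =>
    rw [List.pairwise_cons] at hl
    cases m with
    | zero =>
      have h : a ≤ c := by simpa using h
      rw [List.countP_cons]
      simp [h]
    | succ m =>
      rw [List.getD_cons_succ] at h
      have hm : m < t.length := by simpa using hm
      have h1 := ih hl.2 hm h
      have ha : a ≤ c := by
        refine (hl.1 _ ?_).trans h
        rw [List.getD_eq_getElem _ _ hm]
        exact List.getElem_mem hm
      rw [List.countP_cons]
      simp [ha, h1]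

theorem countP_sort (s : Multiset ℝ) (c : ℝ) :
    (s.sort (· ≤ ·)).countP (· ≤ c) = s.countP (· ≤ c) := by
  conv_rhs => rw [← Multiset.sort_eq s (· ≤ ·)]
  rw [Multiset.coe_countP]

theorem median_le {s : Multiset ℝ} {c : ℝ} (h : s.card / 2 < s.countP (· ≤ c)) :
    median s ≤ c := by
  have hs := Multiset.pairwise_sort s (· ≤ ·)
  rw [← countP_sort] at h
  have h1 := getD_le_of_lt_countP hs h
  have h2 : (s.sort (· ≤ ·)).getD ((s.card - 1) / 2) 0 ≤ c :=
    getD_le_of_lt_countP hs (lt_of_le_of_lt (by omega) h)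
  simp only [median, Multiset.length_sort]
  linarith

theorem lt_countP_of_median_le {s : Multiset ℝ} {c : ℝ} (hs0 : 0 < s.card) (h : median s ≤ c) :
    (s.card - 1) / 2 < s.countP (· ≤ c) := by
  have hs := Multiset.pairwise_sort s (· ≤ ·)
  rw [← countP_sort]
  refine lt_countP_of_getD_le hs (by rw [Multiset.length_sort]; omega) ?_
  -- The lower middle entry is at most the mean of the two middle entries, so a bound on the median
  -- bounds at least that entry.
  have hle : (s.sort (· ≤ ·)).getD ((s.card - 1) / 2) 0 ≤ (s.sort (· ≤ ·)).getD (s.card / 2) 0 := by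
    rw [List.getD_eq_getElem _ _ (by rw [Multiset.length_sort]; omega),
      List.getD_eq_getElem _ _ (by rw [Multiset.length_sort]; omega)]
    exact hs.rel_get_of_le (Fin.mk_le_mk.mpr (by omega))
  simp only [median, Multiset.length_sort] at h
  linarith

variable {d k : ℕ} {V : Matrix (Fin d) (Fin d) ℝ}

theorem countP_dist (V : Matrix (Fin d) (Fin d) ℝ) (b : Fin k → Fin d → ℝ) (j : Fin k) (c : ℝ) :
    ((Finset.univ.erase j).val.map fun i => weightedNorm V (lse V b j - lse V b i)).countP (· ≤ c)
      = ((Finset.univ.erase j).filter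
          fun i => weightedNorm V (lse V b j - lse V b i) ≤ c).card := by
  rw [Multiset.countP_map]
  rfl

/-- Deterministic guarantee of the median-of-means selection: if a strict majority of the
subsample estimators is `r`-close to `θ`, the selected one is `3r`-close. -/
theorem weightedNorm_argmin_sub_le (hV : V.PosSemidef) (b : Fin k → Fin d → ℝ) (θ : Fin d → ℝ)
    {r : ℝ} (hr : 0 ≤ r)
    (hg : (k - 1) / 2 + 2 ≤ (Finset.univ.filter fun j => weightedNorm V (lse V b j - θ) ≤ r).card)
    {j₀ : Fin k} (hj₀ : ∀ j, medianDist V b j₀ ≤ medianDist V b j) :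
    weightedNorm V (lse V b j₀ - θ) ≤ 3 * r := by
  classical
  set G := Finset.univ.filter fun j => weightedNorm V (lse V b j - θ) ≤ r with hG
  have hcard : ∀ j : Fin k, ((Finset.univ.erase j).val.map
      fun i => weightedNorm V (lse V b j - lse V b i)).card = k - 1 := fun j => by
    simp
  by_cases hj : j₀ ∈ G
  · have : weightedNorm V (lse V b j₀ - θ) ≤ r := by simpa [hG] using hj
    linarith
  have hGk : G.card ≤ k - 1 := by
    have : G ⊆ Finset.univ.erase j₀ := fun i hi =>
      Finset.mem_erase.mpr ⟨fun h => hj (h ▸ hi), Finset.mem_univ i⟩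
    simpa using Finset.card_le_card this
  obtain ⟨j₁, hj₁⟩ : G.Nonempty := Finset.card_pos.mp (by omega)
  -- A good index is `2r`-close to every other good one, and these are more than half of the `k - 1`
  -- distances; minimality of `j₀` passes the bound on to it.
  have hmed₁ : medianDist V b j₁ ≤ 2 * r := by
    refine median_le ?_
    rw [hcard, countP_dist]
    have hsub : G.erase j₁ ⊆ (Finset.univ.erase j₁).filter
        fun i => weightedNorm V (lse V b j₁ - lse V b i) ≤ 2 * r := by
      intro i hi
      rw [Finset.mem_erase] at hi
      have h1 : weightedNorm V (lse V b j₁ - θ) ≤ r := by simpa [hG] using hj₁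
      have h2 : weightedNorm V (lse V b i - θ) ≤ r := by simpa [hG] using hi.2
      rw [weightedNorm_sub_comm] at h2
      have := weightedNorm_sub_le hV (lse V b j₁) θ (lse V b i)
      simp only [Finset.mem_filter, Finset.mem_erase, Finset.mem_univ, and_true]
      exact ⟨hi.1, by linarith⟩
    have := Finset.card_le_card hsub
    rw [Finset.card_erase_of_mem hj₁] at this
    omega
  have hmed₀ : medianDist V b j₀ ≤ 2 * r := (hj₀ j₁).trans hmed₁
  have hcnt := lt_countP_of_median_le (by rw [hcard]; omega) hmed₀
  rw [hcard, countP_dist] at hcnt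
  set N := (Finset.univ.erase j₀).filter
    fun i => weightedNorm V (lse V b j₀ - lse V b i) ≤ 2 * r with hN
  -- Both sets avoid `j₀`, and their sizes add up to more than the `k - 1` remaining indices. A
  -- common element is `r`-close to `θ` and `2r`-close to the estimator `j₀`.
  have hinter : (G ∩ N).Nonempty := by
    rw [← Finset.card_pos]
    have h1 : (G ∪ N).card ≤ k - 1 := by
      have : G ∪ N ⊆ Finset.univ.erase j₀ := by
        intro i hi
        rcases Finset.mem_union.mp hi with hi | hi
        · exact Finset.mem_erase.mpr ⟨fun h => hj (h ▸ hi), Finset.mem_univ i⟩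
        · exact (Finset.mem_filter.mp hi).1
      simpa using Finset.card_le_card this
    have h2 := Finset.card_union_add_card_inter G N
    omega
  obtain ⟨i, hi⟩ := hinter
  rw [Finset.mem_inter] at hi
  have h1 : weightedNorm V (lse V b i - θ) ≤ r := by simpa [hG] using hi.1
  have h2 : weightedNorm V (lse V b j₀ - lse V b i) ≤ 2 * r := (Finset.mem_filter.mp hi.2).2
  have := weightedNorm_sub_le hV (lse V b j₀) (lse V b i) θ
  linarith

end Median

/-! ### One batch of LinUCB-VVN in dimension three -/

section Batch

theorem normalize_dotProduct {d : ℕ} (a x : Fin d → ℝ) :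
    normalize a ⬝ᵥ x = (√(a ⬝ᵥ a))⁻¹ * (a ⬝ᵥ x) := by
  rw [normalize, smul_dotProduct, smul_eq_mul]

theorem normalize_dotProduct_self {d : ℕ} {a : Fin d → ℝ} (ha : 0 < a ⬝ᵥ a) :
    normalize a ⬝ᵥ normalize a = 1 := by
  rw [normalize_dotProduct, dotProduct_comm a (normalize a), normalize_dotProduct, ← mul_assoc, ← mul_inv,
    Real.mul_self_sqrt ha.le, inv_mul_cancel₀ ha.ne']

theorem normalize_self_cases {d : ℕ} (a : Fin d → ℝ) :
    normalize a ⬝ᵥ normalize a = 1 ∨ normalize a = 0 := by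
  rcases (dotProduct_self_nonneg' a).eq_or_lt with h | h
  · right
    rw [normalize, ← h, Real.sqrt_zero, inv_zero, zero_smul]
  · exact Or.inl (normalize_dotProduct_self h)

theorem dotProduct_sq_le {d : ℕ} (x y : Fin d → ℝ) : (x ⬝ᵥ y) ^ 2 ≤ (x ⬝ᵥ x) * (y ⬝ᵥ y) := by
  simpa [dotProduct, sq] using Finset.sum_mul_sq_le_sq_mul_sq Finset.univ x y

variable {k : ℕ} (tb : TieBreak 3) (S : State 3 k)

/-- The perturbed centre whose normalisation is the action `A^±_i`. -/
noncomputable def perturbed (i : Fin (3 - 1)) (sgn : Bool) : Fin 3 → ℝ :=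
  normalize S.est + ((if sgn then 1 else -1) * (√(lamMin S.design))⁻¹) •
    tb.eigvec S.design (Fin.castLE (Nat.sub_le 3 1) i)

theorem nextAction_eq (i : Fin (3 - 1)) (sgn : Bool) :
    nextAction tb S i sgn = normalize (perturbed tb S i sgn) := rfl

variable {S}

theorem inv_sqrt_lamMin_bounds (hS : IsBddBelow 2 S.design) :
    0 < (√(lamMin S.design))⁻¹ ∧ (√(lamMin S.design))⁻¹ ^ 2 ≤ 1 / 2 := by
  have h := le_lamMin hS
  refine ⟨inv_pos.mpr (Real.sqrt_pos.mpr (by linarith)), ?_⟩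
  rw [inv_pow, Real.sq_sqrt (by linarith), one_div]
  exact inv_anti₀ two_pos h

theorem eigvec_dotProduct_self (hS : IsBddBelow 2 S.design) (i : Fin 3) :
    tb.eigvec S.design i ⬝ᵥ tb.eigvec S.design i = 1 := by
  simpa using (tb.eigvec_spec _ hS.symm).1 i i

theorem perturbed_dotProduct_self (hS : IsBddBelow 2 S.design) (i : Fin (3 - 1)) (sgn : Bool) :
    0 < perturbed tb S i sgn ⬝ᵥ perturbed tb S i sgn ∧
      perturbed tb S i sgn ⬝ᵥ perturbed tb S i sgn ≤ 3 := by
  obtain ⟨h0, h1⟩ := inv_sqrt_lamMin_bounds hS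
  set η := (√(lamMin S.design))⁻¹
  set c := normalize S.est with hc
  set v := tb.eigvec S.design (Fin.castLE (Nat.sub_le 3 1) i)
  have hv : v ⬝ᵥ v = 1 := eigvec_dotProduct_self tb hS _
  set e : ℝ := if sgn then 1 else -1 with he
  have he2 : e ^ 2 = 1 := by rw [he]; split_ifs <;> norm_num
  have hexp : perturbed tb S i sgn ⬝ᵥ perturbed tb S i sgn
      = c ⬝ᵥ c + 2 * (e * (c ⬝ᵥ v) * η) + η ^ 2 := by
    change (c + (e * η) • v) ⬝ᵥ (c + (e * η) • v) = _
    simp only [add_dotProduct, dotProduct_add, smul_dotProduct, dotProduct_smul, smul_eq_mul, hv,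
      dotProduct_comm v c]
    linear_combination η ^ 2 * he2
  -- This follows from `η² ≤ 1/2`, and gives `(1 - η)² > 0` and `1 + 2η + η² ≤ 3`, the extreme
  -- values when the centre is a unit vector.
  have hη : η < 3 / 4 := by nlinarith
  rw [hexp]
  rcases normalize_self_cases S.est with h | h
  · rw [← hc] at h
    have hcv : (c ⬝ᵥ v) ^ 2 ≤ 1 := by simpa [h, hv] using dotProduct_sq_le c v
    have hb : |e * (c ⬝ᵥ v)| ≤ 1 := by
      rw [← sq_le_one_iff_abs_le_one, mul_pow, he2, one_mul]; exact hcv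
    obtain ⟨hb1, hb2⟩ := abs_le.mp hb
    rw [h]
    constructor <;> nlinarith
  -- A zero estimate is normalised to zero, and then only `η v` remains.
  · rw [← hc] at h
    simp only [h, zero_dotProduct, mul_zero, zero_mul, zero_add]
    exact ⟨by positivity, by linarith⟩

theorem nextAction_dotProduct_self (hS : IsBddBelow 2 S.design) (i : Fin (3 - 1)) (sgn : Bool) :
    nextAction tb S i sgn ⬝ᵥ nextAction tb S i sgn = 1 :=
  normalize_dotProduct_self (perturbed_dotProduct_self tb hS i sgn).1

theorem nextAction_dotProduct_sq_ge (hS : IsBddBelow 2 S.design) (i : Fin (3 - 1)) (sgn : Bool)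
    (x : Fin 3 → ℝ) :
    (perturbed tb S i sgn ⬝ᵥ x) ^ 2 / 3 ≤ (nextAction tb S i sgn ⬝ᵥ x) ^ 2 := by
  obtain ⟨h0, h3⟩ := perturbed_dotProduct_self tb hS i sgn
  rw [nextAction_eq, normalize_dotProduct, mul_pow, inv_pow, Real.sq_sqrt h0.le, mul_comm,
    ← div_eq_mul_inv]
  gcongr

/-- The cross terms of the two signs cancel: `(p + ηq)² + (p - ηq)² ≥ 2η²q²` with `η² = 1 / λ_min`.
The factor `3` bounds the squared lengths before normalisation. -/
theorem nextAction_pair_ge (hS : IsBddBelow 2 S.design) (i : Fin (3 - 1)) (x : Fin 3 → ℝ) :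
    2 / (3 * lamMin S.design) *
        (tb.eigvec S.design (Fin.castLE (Nat.sub_le 3 1) i) ⬝ᵥ x) ^ 2
      ≤ (nextAction tb S i true ⬝ᵥ x) ^ 2 + (nextAction tb S i false ⬝ᵥ x) ^ 2 := by
  refine le_trans ?_ (add_le_add (nextAction_dotProduct_sq_ge tb hS i true x)
    (nextAction_dotProduct_sq_ge tb hS i false x))
  have hl := le_lamMin hS
  have hη : (√(lamMin S.design))⁻¹ ^ 2 = (lamMin S.design)⁻¹ := by
    rw [inv_pow, Real.sq_sqrt (by linarith)]
  simp only [perturbed, add_dotProduct, smul_dotProduct, smul_eq_mul, if_true, Bool.false_eq_true,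
    if_false]
  set η := (√(lamMin S.design))⁻¹
  set p := normalize S.est ⬝ᵥ x
  set q := tb.eigvec S.design (Fin.castLE (Nat.sub_le 3 1) i) ⬝ᵥ x
  have h1 : 2 / (3 * lamMin S.design) = 2 / 3 * η ^ 2 := by
    rw [hη]; field_simp
  rw [h1]
  nlinarith [sq_nonneg p]

variable (S) (w : ℝ) (X : Fin (3 - 1) → Bool → Fin k → ℝ)

theorem next_design_form (x : Fin 3 → ℝ) :
    x ⬝ᵥ ((S.next tb w X).design *ᵥ x) = x ⬝ᵥ (S.design *ᵥ x) +
      w * ∑ i, ((nextAction tb S i true ⬝ᵥ x) ^ 2 + (nextAction tb S i false ⬝ᵥ x) ^ 2) := by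
  have h : ∀ a : Fin 3 → ℝ, x ⬝ᵥ (Matrix.vecMulVec a a *ᵥ x) = (a ⬝ᵥ x) ^ 2 := fun a => by
    rw [Matrix.vecMulVec_mulVec, dotProduct_smul, dotProduct_comm x a]
    simp [sq]
  simp only [State.next, Matrix.add_mulVec, Matrix.smul_mulVec, Matrix.sum_mulVec, dotProduct_add,
    dotProduct_smul, dotProduct_sum, h, smul_eq_mul]

theorem next_design_isSymm (hS : S.design.IsSymm) : (S.next tb w X).design.IsSymm := by
  have h : ∀ a : Fin 3 → ℝ, (Matrix.vecMulVec a a)ᵀ = Matrix.vecMulVec a a := fun a =>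
    Matrix.transpose_vecMulVec a a
  simp only [State.next, Matrix.IsSymm, Matrix.transpose_add, Matrix.transpose_smul,
    Matrix.transpose_sum, h, hS.eq]

variable {S} {w}

/-- Only the two lowest eigendirections are probed, and each gains at least `2w / (3 λ_min)`. The
top one already carries `λ_max`, which explains the minimum. -/
theorem next_design_bddBelow (hS : IsBddBelow 2 S.design) (hw : 0 ≤ w) :
    IsBddBelow (min (lamMin S.design + 2 * w / (3 * lamMin S.design)) (lamMax S.design))
      (S.next tb w X).design := by
  refine ⟨next_design_isSymm tb S w X hS.symm, fun x => ?_⟩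
  have hv := tb.eigvec_spec _ hS.symm
  obtain ⟨l, hmono, h0, h1, hf⟩ := hv.exists_eigenvalues hS.symm
  have hl := le_lamMin hS
  rw [next_design_form, hf, dotProduct_eq_sum_coords hv.1]
  have hsum : ∀ f : Fin (3 - 1) → ℝ, ∑ i, f i = f ⟨0, by norm_num⟩ + f ⟨1, by norm_num⟩ := fun f =>
    Fin.sum_univ_two f
  have hp0 := nextAction_pair_ge tb hS ⟨0, by norm_num⟩ x
  have hp1 := nextAction_pair_ge tb hS ⟨1, by norm_num⟩ x
  rw [hsum, Fin.sum_univ_three, Fin.sum_univ_three]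
  change _ * (tb.eigvec S.design 0 ⬝ᵥ x) ^ 2 ≤ _ at hp0
  change _ * (tb.eigvec S.design 1 ⬝ᵥ x) ^ 2 ≤ _ at hp1
  set a := tb.eigvec S.design 0 ⬝ᵥ x
  set b := tb.eigvec S.design 1 ⬝ᵥ x
  set c := tb.eigvec S.design 2 ⬝ᵥ x
  have h01 : l 0 ≤ l 1 := hmono (by decide)
  have h2 : l 2 = lamMax S.design := h1
  set m := min (lamMin S.design + 2 * w / (3 * lamMin S.design)) (lamMax S.design)
  have hm1 : m ≤ lamMin S.design + w * (2 / (3 * lamMin S.design)) :=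
    (min_le_left _ _).trans_eq (by ring)
  have hm2 : m ≤ l 2 := (min_le_right _ _).trans_eq h2.symm
  set δ := 2 / (3 * lamMin S.design)
  have e0 := mul_le_mul_of_nonneg_right hm1 (sq_nonneg a)
  have e1 := mul_le_mul_of_nonneg_right (hm1.trans (add_le_add_left (h0 ▸ h01) _)) (sq_nonneg b)
  have e2 := mul_le_mul_of_nonneg_right hm2 (sq_nonneg c)
  have e3 := mul_le_mul_of_nonneg_left (add_le_add hp0 hp1) hw
  rw [← h0] at e0
  linarith

theorem next_design_lamMax_le (hS : IsBddBelow 2 S.design) (hw : 0 ≤ w) :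
    lamMax (S.next tb w X).design ≤ lamMax S.design + 4 * w := by
  refine lamMax_le (next_design_isSymm tb S w X hS.symm) fun x => ?_
  rw [next_design_form]
  have h := le_lamMax_mul hS.symm x
  have hA : ∀ i sgn, (nextAction tb S i sgn ⬝ᵥ x) ^ 2 ≤ x ⬝ᵥ x := fun i sgn => by
    simpa [nextAction_dotProduct_self tb hS] using dotProduct_sq_le (nextAction tb S i sgn) x
  have hsum : ∑ i, ((nextAction tb S i true ⬝ᵥ x) ^ 2 + (nextAction tb S i false ⬝ᵥ x) ^ 2)
      ≤ ∑ _i : Fin (3 - 1), 2 * (x ⬝ᵥ x) :=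
    Finset.sum_le_sum fun i _ => by linarith [hA i true, hA i false]
  have h4 : ∑ _i : Fin (3 - 1), 2 * (x ⬝ᵥ x) = 4 * (x ⬝ᵥ x) := by
    rw [Finset.sum_const, Finset.card_univ, Fintype.card_fin, nsmul_eq_mul]; norm_num; ring
  have := mul_le_mul_of_nonneg_left (hsum.trans_eq h4) hw
  linarith

theorem next_design_trace (hS : IsBddBelow 2 S.design) :
    (S.next tb w X).design.trace = S.design.trace + 4 * w := by
  simp only [State.next, Matrix.trace_add, Matrix.trace_smul, Matrix.trace_sum,
    Matrix.trace_vecMulVec, nextAction_dotProduct_self tb hS, smul_eq_mul]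
  rw [Finset.sum_const, Finset.card_univ, Fintype.card_fin, nsmul_eq_mul]
  norm_num; ring

end Batch

/-! ### Eigenvalue control along a run -/

section Run

/-- The constant `1 / (12 √2 β_w)` in the weight function. -/
noncomputable def weightConst : ℝ := 1 / (12 * √2 * betaW 3 2)

theorem hundred_le_betaW : 100 ≤ betaW 3 2 := by
  have h : 5 ≤ √(9 * (3 : ℕ) : ℝ) := by
    rw [Real.le_sqrt' (by norm_num)]; norm_num
  rw [betaW]
  nlinarith

theorem weightConst_pos : 0 < weightConst := by
  have := hundred_le_betaW
  rw [weightConst]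
  positivity

theorem weightConst_le : weightConst ≤ 1 / 1000 := by
  have := hundred_le_betaW
  have h : 1 ≤ √(2 : ℝ) := by rw [Real.le_sqrt' (by norm_num)]; norm_num
  rw [weightConst]
  apply one_div_le_one_div_of_le (by norm_num)
  nlinarith

theorem weight_eq (V : Matrix (Fin 3) (Fin 3) ℝ) : weight 3 2 V = weightConst * √(lamMax V) := by
  rw [weight, weightConst]
  norm_num
  ring

/-- The eigenvalue bounds satisfied by the design matrix after `s` batches. -/
structure DesignBounds (s : ℕ) (V : Matrix (Fin 3) (Fin 3) ℝ) : Prop where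
  bddBelow : IsBddBelow 2 V
  lamMax_le_sq : lamMax V ≤ 3 * lamMin V ^ 2
  trace_ge : (2 + weightConst * s) ^ 2 ≤ V.trace
  lamMax_le : lamMax V ≤ (3 + s) ^ 2

theorem DesignBounds.weightConst_mul_le {s : ℕ} {V : Matrix (Fin 3) (Fin 3) ℝ}
    (h : DesignBounds s V) : (2 + weightConst * s) ^ 2 / 3 ≤ lamMax V := by
  have h1 := trace_le_lamMax h.bddBelow.symm
  have h2 := h.trace_ge
  norm_num at h1
  linarith

/-- Take square roots in `(2 + C s)² ≤ 3 λ_max ≤ 9 λ_min²`, with `C` the weight constant. -/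
theorem DesignBounds.le_lamMin {s : ℕ} {V : Matrix (Fin 3) (Fin 3) ℝ}
    (h : DesignBounds s V) : weightConst / 3 * (s + 1) ≤ lamMin V := by
  have h1 := h.weightConst_mul_le
  have h2 := h.lamMax_le_sq
  have h3 := PSMAQB.le_lamMin h.bddBelow
  have hC := weightConst_pos
  have hC' := weightConst_le
  have h4 : (2 + weightConst * s) ^ 2 ≤ (3 * lamMin V) ^ 2 := by nlinarith
  have h5 := (sq_le_sq₀ (by positivity) (by linarith)).mp h4
  nlinarith

theorem designBounds_zero : DesignBounds 0 ((2 : ℝ) • (1 : Matrix (Fin 3) (Fin 3) ℝ)) := by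
  have hb : IsBddBelow 2 ((2 : ℝ) • (1 : Matrix (Fin 3) (Fin 3) ℝ)) :=
    ⟨by simp [Matrix.IsSymm], fun x => by simp [Matrix.smul_mulVec]⟩
  have h1 : lamMax ((2 : ℝ) • (1 : Matrix (Fin 3) (Fin 3) ℝ)) ≤ 2 :=
    PSMAQB.lamMax_le hb.symm fun x => by simp [Matrix.smul_mulVec]
  have h2 := PSMAQB.le_lamMin hb
  refine ⟨hb, by nlinarith, ?_, ?_⟩
  · simp [Matrix.trace_smul]; norm_num
  · norm_num; linarith

/-- Since the weight is proportional to `√λ_max`, the trace obeys a discrete form of `y' ≥ c √y` and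
grows quadratically. Meanwhile the relative gain of `λ_min²` keeps up with that of `λ_max`. -/
theorem designBounds_next {k s : ℕ} (tb : TieBreak 3) {S : State 3 k}
    (h : DesignBounds s S.design) (h0 : s = 0 → lamMax S.design ≤ 2)
    (X : Fin (3 - 1) → Bool → Fin k → ℝ) :
    DesignBounds (s + 1) (S.next tb (if s = 0 then 1 else weight 3 2 S.design) X).design := by
  have hS := h.bddBelow
  have hl := PSMAQB.le_lamMin hS
  have hlm := lamMin_le_lamMax hS.symm
  have hC := weightConst_pos
  have hC' := weightConst_le
  set L := lamMax S.design
  set l := lamMin S.design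
  set w : ℝ := if s = 0 then 1 else weight 3 2 S.design with hw
  have hL1 : 1 ≤ √L := by rw [Real.le_sqrt' (by norm_num)]; linarith
  have hLL : √L ^ 2 = L := Real.sq_sqrt (by linarith)
  have hw0 : 0 ≤ w := by
    rw [hw]; split_ifs
    · exact zero_le_one
    · rw [weight_eq]; positivity
  have hbd := next_design_bddBelow tb X hS hw0
  have hMax := next_design_lamMax_le tb X hS hw0
  have hT := next_design_trace tb (w := w) X hS
  have hMin := PSMAQB.le_lamMin hbd
  have hmin2 : 2 ≤ min (l + 2 * w / (3 * l)) L := by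
    refine le_min ?_ (by linarith)
    have : 0 ≤ 2 * w / (3 * l) := by positivity
    linarith
  refine ⟨⟨hbd.symm, fun x => ?_⟩, ?_, ?_, ?_⟩
  · exact (mul_le_mul_of_nonneg_right hmin2 (dotProduct_self_nonneg' x)).trans (hbd.le x)
  · have hsq : min (l + 2 * w / (3 * l)) L ^ 2 ≤ lamMin (S.next tb w X).design ^ 2 :=
      pow_le_pow_left₀ (by linarith) hMin 2
    have h4 : L + 4 * w ≤ 3 * min (l + 2 * w / (3 * l)) L ^ 2 := by
      rcases min_cases (l + 2 * w / (3 * l)) L with ⟨he, -⟩ | ⟨he, -⟩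
      · rw [he]
        -- The cross term of `3 (l + 2w / (3l))²` is exactly `4w`, the most that `λ_max` can gain.
        have h5 : l * (2 * w / (3 * l)) = 2 * w / 3 := by field_simp
        have h6 := h.lamMax_le_sq
        nlinarith [sq_nonneg (2 * w / (3 * l))]
      · rw [he]
        have hwL : w ≤ L := by
          rw [hw]; split_ifs
          · linarith
          · rw [weight_eq]; nlinarith
        nlinarith
    linarith
  · rw [hT]
    rcases Nat.eq_zero_or_pos s with rfl | hs
    · have := h.trace_ge
      simp only [hw, if_true]
      push_cast at this ⊢
      nlinarith
    · have hw' : w = weightConst * √L := by rw [hw, if_neg hs.ne', weight_eq]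
      have h1 := h.weightConst_mul_le
      have h2 := h.trace_ge
      have hs0 : (0 : ℝ) ≤ s := Nat.cast_nonneg s
      set y := 2 + weightConst * s with hy
      have hy2 : 2 ≤ y := by rw [hy]; nlinarith
      -- Here `11/20 < 1/√3`, while `4 · 11/20 = 11/5 > 2`: the gain `4 C √L` exceeds `2 C y`, with
      -- room for the `C²` in `(y + C)²`.
      have h3 : 11 / 20 * y ≤ √L := by
        rw [Real.le_sqrt' (by positivity)]; nlinarith
      rw [hw']
      push_cast
      have : 2 + weightConst * (s + 1) = y + weightConst := by rw [hy]; ring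
      rw [this]
      nlinarith [mul_le_mul_of_nonneg_left h3 hC.le]
  · refine hMax.trans ?_
    rcases Nat.eq_zero_or_pos s with rfl | hs
    · have := h0 rfl
      simp only [hw, if_true]
      norm_num
      linarith
    · have hw' : w = weightConst * √L := by rw [hw, if_neg hs.ne', weight_eq]
      have hL := h.lamMax_le
      have h1 : √L ≤ 3 + s := by
        rw [Real.sqrt_le_left (by positivity)]; exact hL
      rw [hw']
      push_cast
      nlinarith [mul_le_mul_of_nonneg_left h1 hC.le]

theorem designBounds_run (tb : TieBreak 3) (k : ℕ) (init : Fin 3 → ℝ) (X : ℕ → ℝ) (s : ℕ) :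
    DesignBounds s (run tb 2 k (weight 3 2) init X s).design := by
  induction s with
  | zero => exact designBounds_zero
  | succ s ih =>
    refine designBounds_next tb ih (fun hs => ?_) _
    subst hs
    exact PSMAQB.lamMax_le designBounds_zero.bddBelow.symm fun x => by
      simp [run, Matrix.smul_mulVec]

end Run

/-! ### Bloch vectors -/

section Bloch

theorem blochProj_eq (a : Fin 3 → ℝ) : blochProj a =
    !![(1 + (a 2 : ℂ)) / 2, ((a 0 : ℂ) - a 1 * Complex.I) / 2;
      ((a 0 : ℂ) + a 1 * Complex.I) / 2, (1 - (a 2 : ℂ)) / 2] := by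
  ext i j
  fin_cases i <;> fin_cases j <;> simp [blochProj] <;> ring

theorem overlap_blochProj (a b : Fin 3 → ℝ) :
    overlap (blochProj a) (blochProj b) = (1 + a ⬝ᵥ b) / 2 := by
  rw [overlap, blochProj_eq, blochProj_eq]
  simp [Matrix.trace_fin_two, dotProduct, Fin.sum_univ_three]
  ring

theorem blochProj_isHermitian (a : Fin 3 → ℝ) : (blochProj a).IsHermitian := by
  rw [blochProj_eq]
  ext i j
  fin_cases i <;> fin_cases j <;> simp [Complex.ext_iff]

theorem blochProj_mem_pureStates {a : Fin 3 → ℝ} (ha : a ⬝ᵥ a = 1) :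
    blochProj a ∈ pureStates 2 := by
  have ha' : a 0 * a 0 + a 1 * a 1 + a 2 * a 2 = 1 := by
    simpa [dotProduct, Fin.sum_univ_three] using ha
  have hc : (a 0 : ℂ) * a 0 + a 1 * a 1 + a 2 * a 2 = 1 := by exact_mod_cast ha'
  have hI := Complex.I_sq
  have hsq : blochProj a * blochProj a = blochProj a := by
    rw [blochProj_eq]
    ext i j
    fin_cases i <;> fin_cases j <;> simp [Matrix.mul_apply, Fin.sum_univ_two]
    · linear_combination hc / 4 - (a 1 : ℂ) ^ 2 * hI / 4
    · ring
    · ring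
    · linear_combination hc / 4 - (a 1 : ℂ) ^ 2 * hI / 4
  refine ⟨?_, ?_, hsq⟩
  · have h := Matrix.posSemidef_conjTranspose_mul_self (blochProj a)
    rwa [(blochProj_isHermitian a).eq, hsq] at h
  · rw [blochProj_eq]
    simp [Matrix.trace_fin_two]
    ring

theorem exists_blochProj_of_mem_pureStates {ρ : Matrix (Fin 2) (Fin 2) ℂ}
    (hρ : ρ ∈ pureStates 2) : ∃ a : Fin 3 → ℝ, a ⬝ᵥ a = 1 ∧ ρ = blochProj a := by
  obtain ⟨hpos, htr, hsq⟩ := hρ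
  have hH := hpos.isHermitian
  have h00 : (ρ 0 0).im = 0 := by
    have := congrArg Complex.im (hH.apply 0 0)
    simp at this; linarith
  have h11 : (ρ 1 1).im = 0 := by
    have := congrArg Complex.im (hH.apply 1 1)
    simp at this; linarith
  have h10 : ρ 1 0 = star (ρ 0 1) := (hH.apply 1 0).symm
  have h10r : (ρ 1 0).re = (ρ 0 1).re := by rw [h10]; simp
  have h10i : (ρ 1 0).im = -(ρ 0 1).im := by rw [h10]; simp
  have htr' : (ρ 0 0).re + (ρ 1 1).re = 1 := by
    have := congrArg Complex.re htr
    simpa [Matrix.trace_fin_two] using this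
  have hs : (ρ 0 0).re * (ρ 0 0).re + ((ρ 0 1).re ^ 2 + (ρ 0 1).im ^ 2) = (ρ 0 0).re := by
    have := congrArg Complex.re (congrFun (congrFun hsq 0) 0)
    simp only [Matrix.mul_apply, Fin.sum_univ_two, Complex.add_re, Complex.mul_re, h00, h10r,
      h10i] at this
    linarith
  -- The Bloch coordinates are read off the entries; that they form a unit vector is the `(0, 0)`
  -- entry of `ρ² = ρ`.
  refine ⟨![2 * (ρ 0 1).re, -2 * (ρ 0 1).im, (ρ 0 0).re - (ρ 1 1).re], ?_, ?_⟩
  · have h1 : (ρ 1 1).re = 1 - (ρ 0 0).re := by linarith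
    simp [dotProduct, Fin.sum_univ_three, h1]
    linarith
  · rw [blochProj_eq]
    ext i j
    fin_cases i <;> fin_cases j <;> simp [Complex.ext_iff, h00, h11, h10r, h10i] <;> linarith

theorem dotProduct_mem_Icc {d : ℕ} {a b : Fin d → ℝ} (ha : a ⬝ᵥ a = 1) (hb : b ⬝ᵥ b = 1) :
    -1 ≤ a ⬝ᵥ b ∧ a ⬝ᵥ b ≤ 1 := by
  have h := dotProduct_sq_le a b
  rw [ha, hb, one_mul] at h
  exact abs_le.mp ((sq_le_one_iff_abs_le_one _).mp h)

theorem sSup_overlap_le {a : Fin 3 → ℝ} (ha : a ⬝ᵥ a = 1) :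
    sSup (overlap (blochProj a) '' pureStates 2) ≤ 1 := by
  refine csSup_le ⟨_, _, blochProj_mem_pureStates ha, rfl⟩ ?_
  rintro _ ⟨P, hP, rfl⟩
  obtain ⟨b, hb, rfl⟩ := exists_blochProj_of_mem_pureStates hP
  rw [overlap_blochProj]
  linarith [(dotProduct_mem_Icc ha hb).2]

theorem rewardProb_blochProj (a b : Fin 3 → ℝ) (x : Bool) :
    rewardProb (blochProj a) (blochProj b) x = (1 + (if x then 1 else -1) * (a ⬝ᵥ b)) / 2 := by
  cases x
  · simp [rewardProb, overlap_blochProj]; ring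
  · simp [rewardProb, overlap_blochProj]

theorem rewardProb_blochProj_nonneg {a b : Fin 3 → ℝ} (ha : a ⬝ᵥ a = 1) (hb : b ⬝ᵥ b = 1)
    (x : Bool) : 0 ≤ rewardProb (blochProj a) (blochProj b) x := by
  rw [rewardProb_blochProj]
  obtain ⟨h1, h2⟩ := dotProduct_mem_Icc ha hb
  split_ifs <;> linarith

end Bloch

/-! ### Expectations over reward sequences -/

section Expectation

variable {d : ℕ} {ρ : Matrix (Fin d) (Fin d) ℂ} {π : Policy d}

theorem sum_fin_succ_bool {n : ℕ} (F : (Fin (n + 1) → Bool) → ℝ) :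
    ∑ x, F x = ∑ h : Fin n → Bool, ∑ b, F (Fin.snoc h b) := by
  rw [← (Fin.snocEquiv fun _ => Bool).sum_comp, Fintype.sum_prod_type, Finset.sum_comm]
  rfl

theorem firstRewards_snoc {n t : ℕ} (h : Fin n → Bool) (b : Bool) (ht : t ≤ n) :
    firstRewards (Fin.snoc h b : Fin (n + 1) → Bool) t (ht.trans n.le_succ)
      = firstRewards h t ht := by
  funext s
  exact Fin.snoc_castSucc (α := fun _ => Bool) b h (Fin.castLE ht s)

theorem trajProb_snoc {n : ℕ} (h : Fin n → Bool) (b : Bool) :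
    trajProb ρ π (Fin.snoc h b : Fin (n + 1) → Bool) =
      trajProb ρ π h * rewardProb ρ (π n h) b := by
  rw [trajProb, Fin.prod_univ_castSucc, trajProb]
  congr 1
  · refine Finset.prod_congr rfl fun t _ => ?_
    rw [Fin.snoc_castSucc (α := fun _ => Bool)]
    congr 1
    exact congrArg (π t) (firstRewards_snoc h b t.2.le)
  · rw [Fin.snoc_last (α := fun _ => Bool)]
    congr 1
    exact congrArg (π n) (firstRewards_snoc h b le_rfl)

theorem expect_succ {n : ℕ} (f : (Fin (n + 1) → Bool) → ℝ) :
    expect ρ π f = expect ρ π fun h : Fin n → Bool =>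
      ∑ b, rewardProb ρ (π n h) b * f (Fin.snoc h b) := by
  rw [expect, sum_fin_succ_bool, expect]
  refine Finset.sum_congr rfl fun h _ => ?_
  rw [Finset.mul_sum]
  refine Finset.sum_congr rfl fun b _ => ?_
  rw [trajProb_snoc, mul_assoc]

theorem sum_rewardProb (P : Matrix (Fin d) (Fin d) ℂ) : ∑ b, rewardProb ρ P b = 1 := by
  simp [rewardProb]

/-- Later rewards are summed out, since conditional probabilities add up to one. Positivity plays no
role. -/
theorem expect_firstRewards {n T : ℕ} (hn : n ≤ T) (g : (Fin n → Bool) → ℝ) :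
    expect ρ π (fun x : Fin T → Bool => g (firstRewards x n hn)) = expect ρ π g := by
  induction T, hn using Nat.le_induction with
  | base => rfl
  | succ T hn ih =>
    rw [expect_succ, ← ih]
    congr 1
    funext h
    simp only [firstRewards_snoc h _ hn, ← Finset.sum_mul, sum_rewardProb, one_mul]

theorem trajProb_nonneg
    (hπ : ∀ (n : ℕ) (h : Fin n → Bool) (b : Bool), 0 ≤ rewardProb ρ (π n h) b)
    {T : ℕ} (x : Fin T → Bool) : 0 ≤ trajProb ρ π x :=
  Finset.prod_nonneg fun _ _ => hπ _ _ _

theorem expect_mono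
    (hπ : ∀ (n : ℕ) (h : Fin n → Bool) (b : Bool), 0 ≤ rewardProb ρ (π n h) b)
    {T : ℕ} {f g : (Fin T → Bool) → ℝ} (h : ∀ x, f x ≤ g x) :
    expect ρ π f ≤ expect ρ π g :=
  Finset.sum_le_sum fun x _ => mul_le_mul_of_nonneg_left (h x) (trajProb_nonneg hπ x)

/-- The expectation form of the supermartingale property, for processes that are functions of the
reward history. -/
theorem expect_le_of_step
    (hπ : ∀ (n : ℕ) (h : Fin n → Bool) (b : Bool), 0 ≤ rewardProb ρ (π n h) b)
    {f : (n : ℕ) → (Fin n → Bool) → ℝ}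
    (hf : ∀ (n : ℕ) (h : Fin n → Bool),
      ∑ b, rewardProb ρ (π n h) b * f (n + 1) (Fin.snoc h b) ≤ f n h) (n : ℕ) :
    expect ρ π (f n) ≤ f 0 Fin.elim0 := by
  induction n with
  | zero =>
    rw [expect, Fintype.sum_unique]
    simp only [trajProb, Finset.univ_eq_empty, Finset.prod_empty, one_mul]
    exact le_of_eq (congrArg _ (Subsingleton.elim _ _))
  | succ n ih =>
    rw [expect_succ]
    exact (expect_mono hπ (hf n)).trans ih

end Expectation

section ExpectationLinear

variable {d T : ℕ} {ρ : Matrix (Fin d) (Fin d) ℂ} {π : Policy d}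

theorem expect_const (c : ℝ) : expect ρ π (fun _ : Fin T → Bool => c) = c := by
  have h := expect_firstRewards (ρ := ρ) (π := π) (Nat.zero_le T) fun _ => c
  rw [h, expect, Fintype.sum_unique]
  simp [trajProb]

theorem expect_add (f g : (Fin T → Bool) → ℝ) :
    expect ρ π (fun x => f x + g x) = expect ρ π f + expect ρ π g := by
  simp only [expect, mul_add, Finset.sum_add_distrib]

theorem expect_const_mul (c : ℝ) (f : (Fin T → Bool) → ℝ) :
    expect ρ π (fun x => c * f x) = c * expect ρ π f := by
  simp only [expect, Finset.mul_sum]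
  exact Finset.sum_congr rfl fun x _ => by ring

theorem expect_sum {ι : Type*} (s : Finset ι) (f : ι → (Fin T → Bool) → ℝ) :
    expect ρ π (fun x => ∑ i ∈ s, f i x) = ∑ i ∈ s, expect ρ π (f i) := by
  simp only [expect, Finset.mul_sum]
  exact Finset.sum_comm

end ExpectationLinear

/-! ### The supermartingale controlling the noise of many subsamples at once -/

section Supermartingale

theorem rescaled_snoc_of_lt {n : ℕ} (h : Fin n → Bool) (b : Bool) {t : ℕ} (ht : t < n) :
    rescaled (Fin.snoc h b : Fin (n + 1) → Bool) t = rescaled h t := by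
  rw [rescaled, rescaled, dif_pos (ht.trans n.lt_succ_self), dif_pos ht]
  have : (⟨t, ht.trans n.lt_succ_self⟩ : Fin (n + 1)) = Fin.castSucc ⟨t, ht⟩ := rfl
  rw [this, Fin.snoc_castSucc (α := fun _ => Bool)]

theorem rescaled_snoc_self {n : ℕ} (h : Fin n → Bool) (b : Bool) :
    rescaled (Fin.snoc h b : Fin (n + 1) → Bool) n = if b then 1 else -1 := by
  rw [rescaled, dif_pos n.lt_succ_self]
  have : (⟨n, n.lt_succ_self⟩ : Fin (n + 1)) = Fin.last n := rfl
  rw [this, Fin.snoc_last (α := fun _ => Bool)]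
  cases b <;> norm_num

/-- A process whose value at time `t` depends only on the rewards before time `t`. -/
def Predictable {α : Type*} (f : ℕ → (ℕ → ℝ) → α) : Prop :=
  ∀ (t : ℕ) (X X' : ℕ → ℝ), (∀ s < t, X s = X' s) → f t X = f t X'

variable {d k : ℕ} (θ : Fin d → ℝ) (A : ℕ → (ℕ → ℝ) → Fin d → ℝ) (w : ℕ → (ℕ → ℝ) → ℝ)
  (σ : ℕ → Fin k) (P : Matrix (Fin d) (Fin d) ℝ)

/-- The weighted noise accumulated by the subsample `j` before round `n`. -/
def noiseSum (X : ℕ → ℝ) (n : ℕ) (j : Fin k) : Fin d → ℝ :=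
  ∑ t ∈ Finset.range n, if σ t = j then (w t X * (X t - θ ⬝ᵥ A t X)) • A t X else 0

/-- The variance budget consumed by the subsample `j` before round `n`. -/
def budget (X : ℕ → ℝ) (n : ℕ) (j : Fin k) : ℝ :=
  ∑ t ∈ Finset.range n, if σ t = j then w t X * (A t X ⬝ᵥ (P *ᵥ A t X)) else 0

/-- The contribution of one subsample to the potential. -/
noncomputable def potentialFactor (X : ℕ → ℝ) (n : ℕ) (j : Fin k) : ℝ :=
  1 + 1 / 4 * (noiseSum θ A w σ X n j ⬝ᵥ (P *ᵥ noiseSum θ A w σ X n j) +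
    (16 / 5 - budget A w σ P X n j))

/-- The weights have been valid inverse variances and the budgets have not been exceeded. -/
def WithinBudget (X : ℕ → ℝ) (n : ℕ) : Prop :=
  (∀ t < n, w t X * (1 - (θ ⬝ᵥ A t X) ^ 2) ≤ 1) ∧ ∀ j : Fin k, budget A w σ P X n j ≤ 16 / 5

open Classical in
/-- The product potential, set to zero once the budget has been exceeded. -/
noncomputable def potential (X : ℕ → ℝ) (n : ℕ) : ℝ :=
  if WithinBudget θ A w σ P X n then ∏ j, potentialFactor θ A w σ P X n j else 0

variable {θ A w σ P}

theorem one_le_potentialFactor (hP : P.PosSemidef) {X : ℕ → ℝ} {n : ℕ}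
    (h : WithinBudget θ A w σ P X n) (j : Fin k) : 1 ≤ potentialFactor θ A w σ P X n j := by
  have h1 := posSemidef_form_nonneg hP (noiseSum θ A w σ X n j)
  have h2 := h.2 j
  rw [potentialFactor]
  linarith

theorem potential_nonneg (hP : P.PosSemidef) (X : ℕ → ℝ) (n : ℕ) :
    0 ≤ potential θ A w σ P X n := by
  rw [potential]
  split_ifs with h
  · exact Finset.prod_nonneg fun j _ => zero_le_one.trans (one_le_potentialFactor hP h j)
  · exact le_rfl

theorem potential_zero_le (X : ℕ → ℝ) : potential θ A w σ P X 0 ≤ (9 / 5) ^ k := by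
  have h : ∀ j : Fin k, potentialFactor θ A w σ P X 0 j = 9 / 5 := fun j => by
    simp only [potentialFactor, noiseSum, budget, Finset.range_zero, Finset.sum_empty,
      zero_dotProduct]
    norm_num
  rw [potential]
  split_ifs
  · rw [Finset.prod_congr rfl fun j _ => h j, Finset.prod_const, Finset.card_univ,
      Fintype.card_fin]
  · positivity

theorem noiseSum_congr (hA : Predictable A) (hw : Predictable w) {X X' : ℕ → ℝ} {n : ℕ}
    (h : ∀ s < n, X s = X' s) (j : Fin k) :
    noiseSum θ A w σ X n j = noiseSum θ A w σ X' n j := by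
  refine Finset.sum_congr rfl fun t ht => ?_
  have ht := Finset.mem_range.mp ht
  have hlt : ∀ s < t, X s = X' s := fun s hs => h s (hs.trans ht)
  rw [hA t X X' hlt, hw t X X' hlt, h t ht]

theorem budget_congr (hA : Predictable A) (hw : Predictable w) {X X' : ℕ → ℝ} {n : ℕ}
    (h : ∀ s < n, s + 1 < n → X s = X' s) (j : Fin k) :
    budget A w σ P X n j = budget A w σ P X' n j := by
  refine Finset.sum_congr rfl fun t ht => ?_
  have ht := Finset.mem_range.mp ht
  have hlt : ∀ s < t, X s = X' s := fun s hs => h s (hs.trans ht) (by omega)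
  rw [hA t X X' hlt, hw t X X' hlt]

/-- The action and weight of round `n` are fixed by the rewards before it, so whether the killing
occurs at step `n + 1` is known before the reward of round `n`. -/
theorem withinBudget_succ_congr (hA : Predictable A) (hw : Predictable w) {X X' : ℕ → ℝ} {n : ℕ}
    (h : ∀ s < n, X s = X' s) (hX : WithinBudget θ A w σ P X (n + 1)) :
    WithinBudget θ A w σ P X' (n + 1) := by
  refine ⟨fun t ht => ?_, fun j => ?_⟩
  · have hlt : ∀ s < t, X s = X' s := fun s hs => h s (by omega)
    rw [← hA t X X' hlt, ← hw t X X' hlt]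
    exact hX.1 t ht
  · rw [← budget_congr hA hw (fun s _ hs => h s (by omega))]
    exact hX.2 j

theorem budget_succ_le (hP : P.PosSemidef) (hw0 : ∀ t X, 0 ≤ w t X) (X : ℕ → ℝ) (n : ℕ)
    (j : Fin k) : budget A w σ P X n j ≤ budget A w σ P X (n + 1) j := by
  rw [budget, budget, Finset.sum_range_succ]
  have h : 0 ≤ if σ n = j then w n X * (A n X ⬝ᵥ (P *ᵥ A n X)) else 0 := by
    split_ifs
    · exact mul_nonneg (hw0 n X) (posSemidef_form_nonneg hP _)
    · exact le_rfl
  linarith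

theorem WithinBudget.of_succ (hP : P.PosSemidef) (hw0 : ∀ t X, 0 ≤ w t X) {X : ℕ → ℝ} {n : ℕ}
    (h : WithinBudget θ A w σ P X (n + 1)) : WithinBudget θ A w σ P X n :=
  ⟨fun t ht => h.1 t (by omega), fun j => (budget_succ_le hP hw0 X n j).trans (h.2 j)⟩

theorem potentialFactor_succ_of_ne (hA : Predictable A) (hw : Predictable w) {X X' : ℕ → ℝ}
    {n : ℕ} (h : ∀ s < n, X s = X' s) {j : Fin k} (hj : σ n ≠ j) :
    potentialFactor θ A w σ P X' (n + 1) j = potentialFactor θ A w σ P X n j := by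
  have h1 : noiseSum θ A w σ X' (n + 1) j = noiseSum θ A w σ X n j := by
    rw [noiseSum_congr hA hw h, noiseSum, Finset.sum_range_succ, if_neg hj, add_zero, noiseSum]
  have h2 : budget A w σ P X' (n + 1) j = budget A w σ P X n j := by
    rw [budget_congr hA hw (X := X) (X' := X') (fun s hs _ => h s hs), budget,
      Finset.sum_range_succ, if_neg hj, add_zero, budget]
  rw [potentialFactor, h1, h2, potentialFactor]

/-- The increment splits into a term linear in the centred reward, which has mean zero, and a
compensated square, whose mean has the sign of `w² · variance - w`. -/
theorem potentialFactor_succ_self (hP : P.PosSemidef) (hA : Predictable A) (hw : Predictable w)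
    {X X' : ℕ → ℝ} {n : ℕ} (h : ∀ s < n, X s = X' s) :
    potentialFactor θ A w σ P X' (n + 1) (σ n) = potentialFactor θ A w σ P X n (σ n) +
      1 / 4 * (2 * (w n X * (X' n - θ ⬝ᵥ A n X)) * (A n X ⬝ᵥ (P *ᵥ noiseSum θ A w σ X n (σ n))) +
        (w n X ^ 2 * (X' n - θ ⬝ᵥ A n X) ^ 2 - w n X) * (A n X ⬝ᵥ (P *ᵥ A n X))) := by
  have h1 : noiseSum θ A w σ X' (n + 1) (σ n) = noiseSum θ A w σ X n (σ n) +
      (w n X * (X' n - θ ⬝ᵥ A n X)) • A n X := by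
    rw [noiseSum_congr hA hw h, noiseSum, Finset.sum_range_succ, if_pos rfl, ← noiseSum,
      hA n X X' h, hw n X X' h]
  have h2 : budget A w σ P X' (n + 1) (σ n) = budget A w σ P X n (σ n) +
      w n X * (A n X ⬝ᵥ (P *ᵥ A n X)) := by
    rw [budget_congr hA hw (X := X) (X' := X') (fun s hs _ => h s hs), budget,
      Finset.sum_range_succ, if_pos rfl, ← budget, hA n X X' h, hw n X X' h]
  rw [potentialFactor, h1, h2, potentialFactor]
  simp only [Matrix.mulVec_add, Matrix.mulVec_smul, add_dotProduct, dotProduct_add,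
    smul_dotProduct, dotProduct_smul, smul_eq_mul,
    dotProduct_mulVec_comm (posSemidef_isSymm hP) (noiseSum θ A w σ X n (σ n)) (A n X)]
  ring

/-- Exactly one factor changes in a round. The other factors are nonnegative and known in advance,
so the one-factor inequality can be multiplied by them; no independence of the subsamples is needed.
-/
theorem sum_potential_succ_le {θ : Fin 3 → ℝ} {A : ℕ → (ℕ → ℝ) → Fin 3 → ℝ}
    {P : Matrix (Fin 3) (Fin 3) ℝ} (hP : P.PosSemidef) (hA : Predictable A) (hw : Predictable w)
    (hw0 : ∀ t X, 0 ≤ w t X) (n : ℕ) (h : Fin n → Bool) :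
    ∑ b, rewardProb (blochProj θ) (blochProj (A n (rescaled h))) b *
        potential θ A w σ P (rescaled (Fin.snoc h b : Fin (n + 1) → Bool)) (n + 1)
      ≤ potential θ A w σ P (rescaled h) n := by
  classical
  set X := rescaled h with hX
  have hagree : ∀ b, ∀ s < n, X s = rescaled (Fin.snoc h b : Fin (n + 1) → Bool) s :=
    fun b s hs => (rescaled_snoc_of_lt h b hs).symm
  by_cases hB : WithinBudget θ A w σ P X (n + 1)
  swap
  · refine le_trans (le_of_eq ?_) (potential_nonneg hP X n)
    refine Finset.sum_eq_zero fun b _ => ?_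
    rw [potential, if_neg, mul_zero]
    exact fun hb => hB (withinBudget_succ_congr hA hw (fun s hs => (hagree b s hs).symm) hb)
  have hBn := hB.of_succ hP hw0
  have hpot : ∀ b, potential θ A w σ P (rescaled (Fin.snoc h b : Fin (n + 1) → Bool)) (n + 1) =
      potentialFactor θ A w σ P (rescaled (Fin.snoc h b : Fin (n + 1) → Bool)) (n + 1) (σ n) *
        ∏ j ∈ Finset.univ.erase (σ n), potentialFactor θ A w σ P X n j := by
    intro b
    rw [potential, if_pos (withinBudget_succ_congr hA hw (hagree b) hB),
      ← Finset.mul_prod_erase _ _ (Finset.mem_univ (σ n))]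
    congr 1
    refine Finset.prod_congr rfl fun j hj => ?_
    exact potentialFactor_succ_of_ne hA hw (hagree b) (Finset.ne_of_mem_erase hj).symm
  simp only [hpot, ← mul_assoc, ← Finset.sum_mul]
  rw [potential, if_pos hBn, ← Finset.mul_prod_erase _ _ (Finset.mem_univ (σ n))]
  refine mul_le_mul_of_nonneg_right ?_
    (Finset.prod_nonneg fun j _ => zero_le_one.trans (one_le_potentialFactor hP hBn j))
  rw [Fintype.sum_bool, potentialFactor_succ_self hP hA hw (hagree true),
    potentialFactor_succ_self hP hA hw (hagree false), rescaled_snoc_self, rescaled_snoc_self,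
    rewardProb_blochProj, rewardProb_blochProj]
  simp only [if_true, Bool.false_eq_true, if_false]
  have hq := posSemidef_form_nonneg hP (A n X)
  have hv := hB.1 n n.lt_succ_self
  have hw1 := hw0 n X
  set q := A n X ⬝ᵥ (P *ᵥ A n X)
  set c := A n X ⬝ᵥ (P *ᵥ noiseSum θ A w σ X n (σ n))
  set μ := θ ⬝ᵥ A n X
  set W := w n X
  -- The mean of the squared centred reward is `1 - μ²`, so the drift is a nonnegative multiple of
  -- `-Wq (1 - W (1 - μ²))`. This is where a weight must not exceed an inverse variance.
  have key : 0 ≤ W * q * (1 - W * (1 - μ ^ 2)) :=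
    mul_nonneg (mul_nonneg hw1 hq) (by linarith)
  nlinarith [key]

/-- The probability-type bound delivered by the potential. -/
theorem expect_potential_le {θ : Fin 3 → ℝ} {A : ℕ → (ℕ → ℝ) → Fin 3 → ℝ}
    {P : Matrix (Fin 3) (Fin 3) ℝ} (hP : P.PosSemidef) (hA : Predictable A) (hw : Predictable w)
    (hw0 : ∀ t X, 0 ≤ w t X) {π : Policy 2}
    (hπA : ∀ (n : ℕ) (h : Fin n → Bool), π n h = blochProj (A n (rescaled h)))
    (hθ : θ ⬝ᵥ θ = 1) (hA1 : ∀ n X, A n X ⬝ᵥ A n X = 1) (n : ℕ) :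
    expect (blochProj θ) π (fun h : Fin n → Bool => potential θ A w σ P (rescaled h) n)
      ≤ (9 / 5) ^ k := by
  have hπ : ∀ (n : ℕ) (h : Fin n → Bool) (b : Bool),
      0 ≤ rewardProb (blochProj θ) (π n h) b := fun n h b => by
    rw [hπA]; exact rewardProb_blochProj_nonneg hθ (hA1 _ _) b
  refine (expect_le_of_step hπ
    (f := fun n (h : Fin n → Bool) => potential θ A w σ P (rescaled h) n) (fun n h => ?_) n).trans
    (potential_zero_le _)
  rw [hπA]
  exact sum_potential_succ_le hP hA hw hw0 n h

/-- If at least `m` subsamples have `P`-energy at least `32`, the potential is at least `9 ^ m`. -/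
theorem le_potential_of_card (hP : P.PosSemidef) {X : ℕ → ℝ} {n m : ℕ}
    (h : WithinBudget θ A w σ P X n) (s : Finset (Fin k)) (hs : m ≤ s.card)
    (hbad : ∀ j ∈ s, 32 ≤ noiseSum θ A w σ X n j ⬝ᵥ (P *ᵥ noiseSum θ A w σ X n j)) :
    (9 : ℝ) ^ m ≤ potential θ A w σ P X n := by
  rw [potential, if_pos h]
  calc (9 : ℝ) ^ m ≤ 9 ^ s.card := pow_le_pow_right₀ (by norm_num) hs
    _ = ∏ _j ∈ s, (9 : ℝ) := by rw [Finset.prod_const]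
    _ ≤ ∏ j ∈ s, potentialFactor θ A w σ P X n j := by
        -- A noisy subsample within its budget has a factor of at least `1 + 32/4 = 9`.
        refine Finset.prod_le_prod (fun _ _ => by norm_num) fun j hj => ?_
        have h1 := hbad j hj
        have h2 := h.2 j
        rw [potentialFactor]
        linarith
    _ ≤ ∏ j, potentialFactor θ A w σ P X n j := by
        have hone : ∀ j, 1 ≤ potentialFactor θ A w σ P X n j := one_le_potentialFactor hP h
        have hcompl : 1 ≤ ∏ j ∈ sᶜ, potentialFactor θ A w σ P X n j := by
          have := Finset.prod_le_prod (s := sᶜ) (fun _ _ => zero_le_one) fun j _ => hone j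
          rwa [Finset.prod_const_one] at this
        rw [← Finset.prod_mul_prod_compl s]
        exact le_mul_of_one_le_right
          (Finset.prod_nonneg fun j _ => zero_le_one.trans (hone j)) hcompl

end Supermartingale

/-! ### Accuracy of the actions under a good estimate -/

section Accuracy

/-- Normalising moves `y` by `|‖y‖ - 1|`, which is at most `‖x - y‖`; the triangle inequality does
the rest. -/
theorem norm_sub_inv_norm_smul_le {E : Type*} [NormedAddCommGroup E] [NormedSpace ℝ E]
    {x : E} (hx : ‖x‖ = 1) (y : E) : ‖x - ‖y‖⁻¹ • y‖ ≤ 2 * ‖x - y‖ := by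
  rcases eq_or_ne y 0 with rfl | hy
  · simp [hx]
  have hy' : ‖y‖ ≠ 0 := norm_ne_zero_iff.mpr hy
  have h1 : y - ‖y‖⁻¹ • y = ((‖y‖ - 1) * ‖y‖⁻¹) • y := by
    rw [sub_mul, one_mul, mul_inv_cancel₀ hy', sub_smul, one_smul]
  have h2 : ‖y - ‖y‖⁻¹ • y‖ = |‖y‖ - ‖x‖| := by
    rw [h1, norm_smul, norm_mul, norm_inv, norm_norm, mul_assoc, inv_mul_cancel₀ hy', mul_one, hx,
      Real.norm_eq_abs]
  have h3 := abs_norm_sub_norm_le y x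
  rw [norm_sub_rev] at h3
  calc ‖x - ‖y‖⁻¹ • y‖ = ‖(x - y) + (y - ‖y‖⁻¹ • y)‖ := by rw [sub_add_sub_cancel]
    _ ≤ ‖x - y‖ + ‖y - ‖y‖⁻¹ • y‖ := norm_add_le _ _
    _ ≤ 2 * ‖x - y‖ := by rw [h2]; linarith

theorem toLp_normalize {d : ℕ} (a : Fin d → ℝ) :
    WithLp.toLp 2 (normalize a) = ‖WithLp.toLp 2 a‖⁻¹ • WithLp.toLp 2 a := by
  rw [normalize, sqrt_dotProduct_self, WithLp.toLp_smul]

theorem norm_toLp_eq_one {d : ℕ} {a : Fin d → ℝ} (ha : a ⬝ᵥ a = 1) :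
    ‖WithLp.toLp 2 a‖ = 1 := by
  rw [← sqrt_dotProduct_self, ha, Real.sqrt_one]

variable {k : ℕ} (tb : TieBreak 3) {S : State 3 k} {θ : Fin 3 → ℝ}

theorem norm_sub_nextAction_le (hS : IsBddBelow 2 S.design) (hθ : θ ⬝ᵥ θ = 1)
    (i : Fin (3 - 1)) (sgn : Bool) :
    ‖WithLp.toLp 2 θ - WithLp.toLp 2 (nextAction tb S i sgn)‖ ≤
      2 * ‖WithLp.toLp 2 θ - WithLp.toLp 2 S.est‖ + 2 * (√(lamMin S.design))⁻¹ := by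
  have hθ1 := norm_toLp_eq_one hθ
  have hη := (inv_sqrt_lamMin_bounds hS).1
  have hA1 := norm_toLp_eq_one (nextAction_dotProduct_self tb hS i sgn)
  -- For a zero estimate normalisation is degenerate, but then `‖θ - θ̂‖ = 1` and the trivial bound
  -- `2` suffices.
  rcases eq_or_ne S.est 0 with h0 | h0
  · have h1 : ‖WithLp.toLp 2 θ - WithLp.toLp 2 (nextAction tb S i sgn)‖ ≤ 2 := by
      refine (norm_sub_le _ _).trans ?_
      rw [hθ1, hA1]; norm_num
    rw [h0, WithLp.toLp_zero, sub_zero, hθ1]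
    linarith
  · have hc1 : ‖WithLp.toLp 2 (normalize S.est)‖ = 1 := by
      refine norm_toLp_eq_one ((normalize_self_cases S.est).resolve_right fun h => h0 ?_)
      have h2 := congrArg (WithLp.toLp 2) h
      rw [toLp_normalize, WithLp.toLp_zero, smul_eq_zero, inv_eq_zero, norm_eq_zero,
        or_self] at h2
      simpa using h2
    have h1 := norm_sub_inv_norm_smul_le hθ1 (WithLp.toLp 2 S.est)
    rw [← toLp_normalize] at h1
    have h2 := norm_sub_inv_norm_smul_le hc1 (WithLp.toLp 2 (perturbed tb S i sgn))
    rw [← toLp_normalize, ← nextAction_eq] at h2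
    have hv := norm_toLp_eq_one (eigvec_dotProduct_self tb hS (Fin.castLE (Nat.sub_le 3 1) i))
    have h3 : ‖WithLp.toLp 2 (normalize S.est) - WithLp.toLp 2 (perturbed tb S i sgn)‖
        = (√(lamMin S.design))⁻¹ := by
      rw [perturbed, WithLp.toLp_add, sub_add_cancel_left, norm_neg, WithLp.toLp_smul, norm_smul,
        hv, mul_one, norm_mul, Real.norm_of_nonneg hη.le]
      cases sgn <;> simp
    rw [h3] at h2
    calc _ ≤ ‖WithLp.toLp 2 θ - WithLp.toLp 2 (normalize S.est)‖ +
          ‖WithLp.toLp 2 (normalize S.est) - WithLp.toLp 2 (nextAction tb S i sgn)‖ :=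
          norm_sub_le_norm_sub_add_norm_sub _ _ _
      _ ≤ _ := add_le_add h1 h2

theorem norm_toLp_sub_sq {d : ℕ} (a b : Fin d → ℝ) :
    ‖WithLp.toLp 2 a - WithLp.toLp 2 b‖ ^ 2 = (a - b) ⬝ᵥ (a - b) := by
  rw [← WithLp.toLp_sub, ← sqrt_dotProduct_self, Real.sq_sqrt (dotProduct_self_nonneg' _)]

/-- If the estimate lies in the confidence region, the actions are `O(λ_min⁻¹)`-accurate. -/
theorem one_sub_dotProduct_nextAction_le (hS : IsBddBelow 2 S.design) (hθ : θ ⬝ᵥ θ = 1)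
    (hgood : weightedNorm S.design (S.est - θ) ^ 2 ≤ betaW 3 2) (i : Fin (3 - 1)) (sgn : Bool) :
    2 * (1 - θ ⬝ᵥ nextAction tb S i sgn) ≤ 5 * betaW 3 2 / lamMin S.design := by
  have hl := le_lamMin hS
  have hβ := hundred_le_betaW
  have h1 := norm_sub_nextAction_le tb hS hθ i sgn
  set D := ‖WithLp.toLp 2 θ - WithLp.toLp 2 S.est‖ with hD
  set η := (√(lamMin S.design))⁻¹ with hηdef
  have hη := (inv_sqrt_lamMin_bounds hS).1
  have hη2 : η ^ 2 = (lamMin S.design)⁻¹ := by rw [hηdef, inv_pow, Real.sq_sqrt (by linarith)]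
  have hA : ‖WithLp.toLp 2 θ - WithLp.toLp 2 (nextAction tb S i sgn)‖ ^ 2
      = 2 * (1 - θ ⬝ᵥ nextAction tb S i sgn) := by
    rw [norm_toLp_sub_sq]
    simp only [sub_dotProduct, dotProduct_sub, hθ, nextAction_dotProduct_self tb hS,
      dotProduct_comm (nextAction tb S i sgn) θ]
    ring
  have hDle : D ^ 2 ≤ betaW 3 2 * η ^ 2 := by
    rw [hD, norm_sub_rev, norm_toLp_sub_sq, hη2, ← div_eq_mul_inv, le_div_iff₀ (by linarith)]
    have h2 := lamMin_mul_le hS.symm (S.est - θ)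
    rw [weightedNorm, Real.sq_sqrt
      (posSemidef_form_nonneg (hS.posSemidef zero_le_two) _)] at hgood
    linarith
  have hD' : D ≤ √(betaW 3 2) * η := by
    refine le_of_sq_le_sq ?_ (by positivity)
    rw [mul_pow, Real.sq_sqrt (by linarith)]
    exact hDle
  have hsb : 10 ≤ √(betaW 3 2) := by
    rw [Real.le_sqrt' (by norm_num)]; linarith
  have hsb2 : √(betaW 3 2) ^ 2 = betaW 3 2 := Real.sq_sqrt (by linarith)
  rw [← hA, div_eq_mul_inv, ← hη2]
  -- From `2 √β η + 2η` and `√β ≥ 10`; squaring gives `121/25 ≤ 5`.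
  have h3 : ‖WithLp.toLp 2 θ - WithLp.toLp 2 (nextAction tb S i sgn)‖
      ≤ 11 / 5 * √(betaW 3 2) * η := by
    nlinarith
  calc _ ≤ (11 / 5 * √(betaW 3 2) * η) ^ 2 := pow_le_pow_left₀ (norm_nonneg _) h3 2
    _ = 121 / 25 * betaW 3 2 * η ^ 2 := by rw [mul_pow, mul_pow, hsb2]; ring
    _ ≤ _ := by
      have : 0 ≤ betaW 3 2 * η ^ 2 := by positivity
      nlinarith

theorem one_sub_sq_le (x : ℝ) : 1 - x ^ 2 ≤ 2 * (1 - x) := by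
  nlinarith [sq_nonneg (1 - x)]

/-- In the confidence region the weight is a valid inverse variance. -/
theorem weight_mul_variance_le {s : ℕ} (hS : DesignBounds s S.design) (hθ : θ ⬝ᵥ θ = 1)
    (hgood : weightedNorm S.design (S.est - θ) ^ 2 ≤ betaW 3 2) (i : Fin (3 - 1)) (sgn : Bool) :
    weight 3 2 S.design * (1 - (θ ⬝ᵥ nextAction tb S i sgn) ^ 2) ≤ 1 := by
  have h1 := one_sub_dotProduct_nextAction_le tb hS.bddBelow hθ hgood i sgn
  have h2 := one_sub_sq_le (θ ⬝ᵥ nextAction tb S i sgn)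
  have hl := le_lamMin hS.bddBelow
  have hβ := hundred_le_betaW
  -- Uses `λ_max ≤ 3 λ_min²` and `√3 < 9/5`. The final comparison is `5 · 9/5 = 9 ≤ 12 √2`.
  have hL : √(lamMax S.design) ≤ 9 / 5 * lamMin S.design := by
    rw [Real.sqrt_le_left (by linarith)]
    nlinarith [hS.lamMax_le_sq]
  have h2' : 7 / 5 ≤ √(2 : ℝ) := by rw [Real.le_sqrt' (by norm_num)]; norm_num
  have hw0 : 0 ≤ weight 3 2 S.design := by
    rw [weight_eq]; exact mul_nonneg weightConst_pos.le (Real.sqrt_nonneg _)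
  calc _ ≤ weight 3 2 S.design * (5 * betaW 3 2 / lamMin S.design) :=
        mul_le_mul_of_nonneg_left (h2.trans h1) hw0
    _ = (√(lamMax S.design) * 5) / (12 * √2 * lamMin S.design) := by
        rw [weight_eq, weightConst]; field_simp
    _ ≤ 1 := by
        rw [div_le_one (by positivity)]
        nlinarith

end Accuracy

/-! ### Rounds and batches -/

section Rounds

variable (tb : TieBreak 3) (k : ℕ) (init : Fin 3 → ℝ)

/-- The state after `s` batches of the qubit algorithm. -/
noncomputable def stateAt (X : ℕ → ℝ) (s : ℕ) : State 3 k := run tb 2 k (weight 3 2) init X s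

/-- The action played in round `t`. -/
noncomputable def roundAction (t : ℕ) (X : ℕ → ℝ) : Fin 3 → ℝ :=
  linUCBAction (by norm_num) tb 2 k (weight 3 2) init X t

/-- The weight of the batch `s`. -/
noncomputable def batchWeight (X : ℕ → ℝ) (s : ℕ) : ℝ :=
  if s = 0 then 1 else weight 3 2 (stateAt tb k init X s).design

/-- The weight of the batch containing round `t`. -/
noncomputable def roundWeight (t : ℕ) (X : ℕ → ℝ) : ℝ :=
  batchWeight tb k init X (t / batchLength 3 k)

/-- The subsample to which round `t` belongs. -/
def roundSubsample {k : ℕ} (hk : 0 < k) (t : ℕ) : Fin k :=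
  ⟨t % (2 * k) / 2, by
    have := Nat.mod_lt t (show 0 < 2 * k by omega)
    omega⟩

theorem batchLength_three : batchLength 3 k = 4 * k := by
  rw [batchLength]

theorem roundOf_lt (s : ℕ) (i : Fin (3 - 1)) (sgn : Bool) (j : Fin k) :
    roundOf 3 k s i sgn j < (s + 1) * batchLength 3 k := by
  have hj := j.2
  obtain ⟨i, hi⟩ := i
  rw [roundOf, batchLength_three, add_mul, one_mul]
  refine Nat.add_lt_add_left ?_ _
  have : i = 0 ∨ i = 1 := by omega
  rcases this with rfl | rfl <;> cases sgn <;> simp <;> omega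

/-- A batch reads only rewards of its own rounds. This is the source of predictability for actions
and weights. -/
theorem stateAt_congr {X X' : ℕ → ℝ} {s : ℕ}
    (h : ∀ t < s * batchLength 3 k, X t = X' t) :
    stateAt tb k init X s = stateAt tb k init X' s := by
  induction s with
  | zero => rfl
  | succ s ih =>
    have h1 := ih fun t ht => h t (ht.trans_le (Nat.mul_le_mul_right _ s.le_succ))
    have h2 : (fun (i : Fin (3 - 1)) sgn (j : Fin k) => X (roundOf 3 k s i sgn j)) =
        fun i sgn j => X' (roundOf 3 k s i sgn j) := by
      funext i sgn j
      exact h _ (roundOf_lt k s i sgn j)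
    simp only [stateAt] at h1
    simp only [stateAt, run, h1, h2]

theorem stateAt_div_congr {X X' : ℕ → ℝ} {t : ℕ} (h : ∀ s < t, X s = X' s) :
    stateAt tb k init X (t / batchLength 3 k) = stateAt tb k init X' (t / batchLength 3 k) :=
  stateAt_congr tb k init fun _ hs => h _ (hs.trans_le (Nat.div_mul_le_self _ _))

theorem predictable_roundAction : Predictable (roundAction tb k init) := fun t X X' h => by
  have := stateAt_div_congr tb k init h
  simp only [stateAt] at this
  simp only [roundAction, linUCBAction, this]

theorem predictable_roundWeight : Predictable (roundWeight tb k init) := fun t X X' h => by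
  simp only [roundWeight, batchWeight, stateAt_div_congr tb k init h]

theorem designBounds_stateAt (X : ℕ → ℝ) (s : ℕ) :
    DesignBounds s (stateAt tb k init X s).design := designBounds_run tb k init X s

theorem batchWeight_nonneg (X : ℕ → ℝ) (s : ℕ) : 0 ≤ batchWeight tb k init X s := by
  rw [batchWeight]
  split_ifs
  · exact zero_le_one
  · rw [weight_eq]
    exact mul_nonneg weightConst_pos.le (Real.sqrt_nonneg _)

theorem roundAction_eq (t : ℕ) (X : ℕ → ℝ) : roundAction tb k init t X =
    nextAction tb (stateAt tb k init X (t / batchLength 3 k)) (actionIndex (by norm_num) k t)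
      (decide (t % 2 = 0)) := rfl

theorem roundAction_dotProduct_self (t : ℕ) (X : ℕ → ℝ) :
    roundAction tb k init t X ⬝ᵥ roundAction tb k init t X = 1 :=
  nextAction_dotProduct_self tb (designBounds_stateAt tb k init X _).bddBelow _ _

theorem roundOf_div (s : ℕ) (i : Fin (3 - 1)) (sgn : Bool) (j : Fin k) :
    roundOf 3 k s i sgn j / batchLength 3 k = s := by
  refine Nat.div_eq_of_lt_le ?_ (roundOf_lt k s i sgn j)
  exact Nat.le_add_right _ _

theorem roundAction_roundOf (X : ℕ → ℝ) (s : ℕ) (i : Fin (3 - 1)) (sgn : Bool) (j : Fin k) :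
    roundAction tb k init (roundOf 3 k s i sgn j) X =
      nextAction tb (stateAt tb k init X s) i sgn := by
  have hlt := roundOf_lt k s i sgn j
  have h2 : roundOf 3 k s i sgn j % batchLength 3 k =
      2 * k * i + (2 * j + if sgn then 0 else 1) := by
    have := Nat.div_add_mod (roundOf 3 k s i sgn j) (batchLength 3 k)
    rw [roundOf_div, mul_comm] at this
    have h3 : roundOf 3 k s i sgn j = s * batchLength 3 k +
      (2 * k * i + 2 * j + if sgn then 0 else 1) := rfl
    omega
  have hj := j.2
  have h1 : actionIndex (d := 3) (by norm_num) k (roundOf 3 k s i sgn j) = i := by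
    refine Fin.ext ?_
    change roundOf 3 k s i sgn j % batchLength 3 k / (2 * k) = i
    rw [h2, Nat.mul_add_div (by omega), Nat.div_eq_of_lt (by split_ifs <;> omega), add_zero]
  -- The batch length is even, so the parity of the round encodes the sign.
  have h4 : decide (roundOf 3 k s i sgn j % 2 = 0) = sgn := by
    have h5 : roundOf 3 k s i sgn j = 2 * (s * (2 * k) + k * i + j) + if sgn then 0 else 1 := by
      rw [roundOf, batchLength_three]; ring
    rw [h5]
    cases sgn <;> simp
  rw [roundAction_eq, roundOf_div, h1, h4]

theorem roundWeight_roundOf (X : ℕ → ℝ) (s : ℕ) (i : Fin (3 - 1)) (sgn : Bool) (j : Fin k) :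
    roundWeight tb k init (roundOf 3 k s i sgn j) X = batchWeight tb k init X s := by
  rw [roundWeight, roundOf_div]

theorem sum_range_two_mul {M : Type*} [AddCommMonoid M] (f : ℕ → M) (n : ℕ) :
    ∑ t ∈ Finset.range (2 * n), f t = ∑ m ∈ Finset.range n, (f (2 * m) + f (2 * m + 1)) := by
  induction n with
  | zero => rfl
  | succ n ih =>
    rw [Finset.sum_range_succ, ← ih, mul_add, mul_one, Finset.sum_range_succ,
      Finset.sum_range_succ, add_assoc]

variable {k}

theorem sum_range_subsample {M : Type*} [AddCommMonoid M] (hk : 0 < k) (g : ℕ → M) (c : ℕ)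
    (j : Fin k) :
    ∑ y ∈ Finset.range (2 * k),
        (if roundSubsample hk (2 * k * c + y) = j then g (2 * k * c + y) else 0)
      = g (2 * k * c + 2 * j) + g (2 * k * c + (2 * j + 1)) := by
  have hσ : ∀ m < k, ∀ e < 2,
      (roundSubsample hk (2 * k * c + (2 * m + e)) = j ↔ m = j) := fun m hm e he => by
    rw [Fin.ext_iff]
    change (2 * k * c + (2 * m + e)) % (2 * k) / 2 = j ↔ _
    rw [Nat.mul_add_mod, Nat.mod_eq_of_lt (by omega)]
    omega
  rw [sum_range_two_mul, Finset.sum_eq_single (j : ℕ)]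
  · have h0 := (hσ j j.2 0 two_pos).mpr rfl
    have h1 := (hσ j j.2 1 one_lt_two).mpr rfl
    rw [add_zero] at h0
    rw [if_pos h0, if_pos h1]
  · intro m hm hmj
    have hm := Finset.mem_range.mp hm
    have h0 := (hσ m hm 0 two_pos).not.mpr hmj
    have h1 := (hσ m hm 1 one_lt_two).not.mpr hmj
    rw [add_zero] at h0
    rw [if_neg h0, if_neg h1, add_zero]
  · intro h
    exact absurd (Finset.mem_range.mpr j.2) h

/-- A batch consists of two blocks of `2k` rounds, one per `i`, and the subsample `j` owns exactly
the rounds `2j` and `2j + 1` of each block. -/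
theorem sum_range_succ_batch {M : Type*} [AddCommMonoid M] (hk : 0 < k) (g : ℕ → M) (s : ℕ)
    (j : Fin k) :
    ∑ t ∈ Finset.range ((s + 1) * batchLength 3 k), (if roundSubsample hk t = j then g t else 0)
      = ∑ t ∈ Finset.range (s * batchLength 3 k), (if roundSubsample hk t = j then g t else 0) +
        ∑ i, (g (roundOf 3 k s i true j) + g (roundOf 3 k s i false j)) := by
  have hsum : ∀ f : Fin (3 - 1) → M, ∑ i, f i = f ⟨0, by norm_num⟩ + f ⟨1, by norm_num⟩ := fun f =>
    Fin.sum_univ_two f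
  have hsplit : (s + 1) * batchLength 3 k = s * batchLength 3 k + 2 * k + 2 * k := by
    rw [batchLength_three]; ring
  have h0 := sum_range_subsample hk g (2 * s) j
  have h1 := sum_range_subsample hk g (2 * s + 1) j
  have e0 : 2 * k * (2 * s) = s * batchLength 3 k := by rw [batchLength_three]; ring
  have e1 : 2 * k * (2 * s + 1) = s * batchLength 3 k + 2 * k := by rw [batchLength_three]; ring
  rw [e0] at h0
  rw [e1] at h1
  rw [hsplit, Finset.sum_range_add, Finset.sum_range_add, h0, h1, hsum, add_assoc]
  simp [roundOf, add_assoc]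

theorem stateAt_succ (X : ℕ → ℝ) (s : ℕ) : stateAt tb k init X (s + 1) =
    (stateAt tb k init X s).next tb (batchWeight tb k init X s)
      fun i sgn j => X (roundOf 3 k s i sgn j) := rfl

/-- Every subsample meets each action of a batch exactly once, so the rounds of any single `j`
rebuild the common design matrix. -/
theorem design_stateAt (hk : 0 < k) (X : ℕ → ℝ) (s : ℕ) (j : Fin k) :
    (stateAt tb k init X s).design = (2 : ℝ) • 1 +
      ∑ t ∈ Finset.range (s * batchLength 3 k), if roundSubsample hk t = j then
        roundWeight tb k init t X •
          Matrix.vecMulVec (roundAction tb k init t X) (roundAction tb k init t X) else 0 := by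
  induction s with
  | zero => simp [stateAt, run]
  | succ s ih =>
    rw [sum_range_succ_batch hk (fun t => roundWeight tb k init t X •
      Matrix.vecMulVec (roundAction tb k init t X) (roundAction tb k init t X)), ← add_assoc, ← ih,
      stateAt_succ]
    simp only [State.next, roundAction_roundOf, roundWeight_roundOf, ← smul_add, ← Finset.smul_sum]

theorem response_stateAt (hk : 0 < k) (X : ℕ → ℝ) (s : ℕ) (j : Fin k) :
    (stateAt tb k init X s).response j =
      ∑ t ∈ Finset.range (s * batchLength 3 k), if roundSubsample hk t = j then
        (roundWeight tb k init t X * X t) • roundAction tb k init t X else 0 := by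
  induction s with
  | zero => simp [stateAt, run]
  | succ s ih =>
    rw [sum_range_succ_batch hk (fun t => (roundWeight tb k init t X * X t) •
      roundAction tb k init t X), ← ih, stateAt_succ]
    simp only [State.next, roundAction_roundOf, roundWeight_roundOf, mul_smul, ← smul_add,
      ← Finset.smul_sum]

end Rounds

/-! ### Concentration of the median-of-means estimator -/

section Concentration

variable (tb : TieBreak 3) {k : ℕ} (hk : 0 < k) (init : Fin 3 → ℝ) (θ : Fin 3 → ℝ)

/-- The noise accumulated by the subsample `j` in the first `s` batches. -/
noncomputable def batchNoise (X : ℕ → ℝ) (s : ℕ) (j : Fin k) : Fin 3 → ℝ :=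
  noiseSum θ (roundAction tb k init) (roundWeight tb k init) (roundSubsample hk) X
    (s * batchLength 3 k) j

/-- After `s` batches the unknown vector lies in the confidence region. -/
def Good (k : ℕ) (X : ℕ → ℝ) (s : ℕ) : Prop :=
  weightedNorm (stateAt tb k init X s).design ((stateAt tb k init X s).est - θ) ^ 2 ≤ betaW 3 2

/-- Split each reward into its mean `⟨θ, A⟩` and noise; the means contribute `(V - 2) θ`, the `2`
being the regularisation. -/
theorem response_eq_batchNoise (X : ℕ → ℝ) (s : ℕ) (j : Fin k) :
    (stateAt tb k init X s).response j = batchNoise tb hk init θ X s j +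
      ((stateAt tb k init X s).design *ᵥ θ - (2 : ℝ) • θ) := by
  rw [response_stateAt tb init hk, design_stateAt tb init hk X s j, Matrix.add_mulVec,
    Matrix.smul_mulVec, Matrix.one_mulVec, add_sub_cancel_left, Matrix.sum_mulVec, batchNoise,
    noiseSum, ← Finset.sum_add_distrib]
  refine Finset.sum_congr rfl fun t _ => ?_
  split_ifs
  · rw [Matrix.smul_mulVec, Matrix.vecMulVec_mulVec, dotProduct_comm θ]
    ext a
    simp
    ring
  · simp

theorem budget_le_trace {P : Matrix (Fin 3) (Fin 3) ℝ} (hP : P.PosSemidef) (X : ℕ → ℝ) (s : ℕ)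
    (j : Fin k) :
    budget (roundAction tb k init) (roundWeight tb k init) (roundSubsample hk) P X
      (s * batchLength 3 k) j ≤ (P * (stateAt tb k init X s).design).trace := by
  rw [design_stateAt tb init hk X s j, Matrix.mul_add, Matrix.trace_add, Matrix.mul_smul,
    Matrix.trace_smul, Matrix.mul_one, Finset.mul_sum, Matrix.trace_sum, budget]
  have h : 0 ≤ P.trace := hP.trace_nonneg
  refine le_add_of_nonneg_of_le (by rw [smul_eq_mul]; linarith)
    (Finset.sum_le_sum fun t _ => le_of_eq ?_)
  split_ifs
  · rw [Matrix.mul_smul, Matrix.trace_smul, trace_mul_vecMulVec, smul_eq_mul]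
  · simp

variable {θ}

theorem weightedNorm_inv_mulVec {V : Matrix (Fin 3) (Fin 3) ℝ} (hV : V.PosDef) (y : Fin 3 → ℝ) :
    weightedNorm V (V⁻¹ *ᵥ y) = √(y ⬝ᵥ (V⁻¹ *ᵥ y)) := by
  have hu : IsUnit V.det := (Matrix.isUnit_iff_isUnit_det V).mp hV.isUnit
  rw [weightedNorm, Matrix.mulVec_mulVec, Matrix.mul_nonsing_inv _ hu, Matrix.one_mulVec,
    dotProduct_comm]

/-- With `y = V⁻¹θ`, combine `2‖y‖² ≤ ⟨θ, y⟩` and `⟨θ, y⟩² ≤ ‖y‖²`. -/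
theorem form_inv_le_half {V : Matrix (Fin 3) (Fin 3) ℝ} (hV : IsBddBelow 2 V)
    (hθ : θ ⬝ᵥ θ = 1) : θ ⬝ᵥ (V⁻¹ *ᵥ θ) ≤ 1 / 2 := by
  have hp := hV.posDef two_pos
  have hu : IsUnit V.det := (Matrix.isUnit_iff_isUnit_det V).mp hp.isUnit
  set y := V⁻¹ *ᵥ θ with hy
  have h1 := hV.le y
  rw [hy, Matrix.mulVec_mulVec, Matrix.mul_nonsing_inv _ hu, Matrix.one_mulVec, ← hy,
    dotProduct_comm y θ] at h1
  have h2 := dotProduct_sq_le θ y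
  rw [hθ, one_mul] at h2
  nlinarith

/-- The error is `V⁻¹` applied to the noise, minus the bias `2 V⁻¹θ`, whose `V`-norm is `√(4 ⟨θ,
V⁻¹θ⟩) ≤ √2`. -/
theorem weightedNorm_lse_sub_le (hθ : θ ⬝ᵥ θ = 1) (X : ℕ → ℝ) (s : ℕ) (j : Fin k) :
    weightedNorm (stateAt tb k init X s).design
        (lse (stateAt tb k init X s).design (stateAt tb k init X s).response j - θ) ≤
      √(batchNoise tb hk init θ X s j ⬝ᵥ
        ((stateAt tb k init X s).design⁻¹ *ᵥ batchNoise tb hk init θ X s j)) + √2 := by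
  have hV := (designBounds_stateAt tb k init X s).bddBelow
  have hp := hV.posDef two_pos
  rw [lse, response_eq_batchNoise tb hk init θ]
  set V := (stateAt tb k init X s).design
  set y := batchNoise tb hk init θ X s j
  have hu : IsUnit V.det := (Matrix.isUnit_iff_isUnit_det V).mp hp.isUnit
  have h1 : V⁻¹ *ᵥ (y + (V *ᵥ θ - (2 : ℝ) • θ)) - θ = V⁻¹ *ᵥ y + -(V⁻¹ *ᵥ ((2 : ℝ) • θ)) := by
    rw [Matrix.mulVec_add, Matrix.mulVec_sub, Matrix.mulVec_mulVec, Matrix.nonsing_inv_mul _ hu,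
      Matrix.one_mulVec]
    abel
  rw [h1]
  refine (weightedNorm_add_le hp.posSemidef _ _).trans ?_
  rw [weightedNorm_neg, weightedNorm_inv_mulVec hp, weightedNorm_inv_mulVec hp]
  refine add_le_add_right (Real.sqrt_le_sqrt ?_) _
  have := form_inv_le_half hV hθ
  rw [Matrix.mulVec_smul, smul_dotProduct, dotProduct_smul, smul_eq_mul, smul_eq_mul]
  linarith

/-- With fewer noisy subsamples, at least `(k - 1) / 2 + 2` estimators would be `r`-close to `θ`,
and median selection would give error at most `3r`, where `(3r)² = β_w`. -/
theorem card_noisy_of_not_good (hθ : θ ⬝ᵥ θ = 1) (X : ℕ → ℝ) (s : ℕ)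
    (hbad : ¬ Good tb init θ k X (s + 1)) :
    k - 1 - (k - 1) / 2 ≤ (Finset.univ.filter fun j => 166 / 5 ≤
      batchNoise tb hk init θ X (s + 1) j ⬝ᵥ ((stateAt tb k init X (s + 1)).design⁻¹ *ᵥ
        batchNoise tb hk init θ X (s + 1) j)).card := by
  set S := stateAt tb k init X (s + 1) with hS
  have hp : S.design.PosSemidef :=
    ((designBounds_stateAt tb k init X (s + 1)).bddBelow.posDef two_pos).posSemidef
  set r : ℝ := √(9 * (3 : ℕ)) + 2 with hr
  have h27 : (5196 / 1000 : ℝ) ≤ √(9 * (3 : ℕ)) := by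
    rw [Real.le_sqrt' (by norm_num)]; norm_num
  have h2 : √(2 : ℝ) ≤ 14143 / 10000 := by
    rw [Real.sqrt_le_left (by norm_num)]; norm_num
  have hest : S.est = lse S.design S.response
      (tb.argmin k hk (medianDist S.design S.response)) := by
    rw [hS, stateAt_succ]
    simp only [State.next, dif_pos hk]
  by_contra hlt
  rw [not_le] at hlt
  refine hbad ?_
  set F := Finset.univ.filter fun j => 166 / 5 ≤
      batchNoise tb hk init θ X (s + 1) j ⬝ᵥ (S.design⁻¹ *ᵥ
        batchNoise tb hk init θ X (s + 1) j) with hF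
  have hsub : Fᶜ ⊆ Finset.univ.filter
      fun j => weightedNorm S.design (lse S.design S.response j - θ) ≤ r := by
    intro j hj
    have hj' : batchNoise tb hk init θ X (s + 1) j ⬝ᵥ (S.design⁻¹ *ᵥ
        batchNoise tb hk init θ X (s + 1) j) < 166 / 5 := by
      simpa [hF] using hj
    refine Finset.mem_filter.mpr ⟨Finset.mem_univ j, ?_⟩
    refine (weightedNorm_lse_sub_le tb hk init hθ X (s + 1) j).trans ?_
    -- The numerical bounds match exactly: `5.7817 + 1.4143 = 5.196 + 2`, the right side being a
    -- lower bound for `r = √27 + 2`.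
    have : √(batchNoise tb hk init θ X (s + 1) j ⬝ᵥ (S.design⁻¹ *ᵥ
        batchNoise tb hk init θ X (s + 1) j)) ≤ 57817 / 10000 := by
      rw [Real.sqrt_le_left (by norm_num)]
      refine hj'.le.trans (by norm_num)
    rw [hr]
    linarith
  have hcard := Finset.card_le_card hsub
  rw [Finset.card_compl, Fintype.card_fin] at hcard
  have hmom := weightedNorm_argmin_sub_le hp S.response θ (r := r) (by positivity)
    (by omega) (j₀ := tb.argmin k hk (medianDist S.design S.response))
    (tb.argmin_spec k hk _)
  rw [← hest] at hmom
  have h0 : 0 ≤ weightedNorm S.design (S.est - θ) := Real.sqrt_nonneg _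
  calc weightedNorm S.design (S.est - θ) ^ 2 ≤ (3 * r) ^ 2 := pow_le_pow_left₀ h0 hmom 2
    _ = betaW 3 2 := by rw [betaW, hr]; ring

/-! ### A finite net of design matrices -/

/-- The entries of a matrix rounded to multiples of `1 / 40`. -/
noncomputable def gridCode (V : Matrix (Fin 3) (Fin 3) ℝ) : Fin 3 → Fin 3 → ℤ :=
  fun i j => ⌊40 * V i j⌋

open Classical in
/-- The inverse of a representative of the matrices with a given code. -/
noncomputable def gridInverse (c : Fin 3 → Fin 3 → ℤ) : Matrix (Fin 3) (Fin 3) ℝ :=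
  if h : ∃ W : Matrix (Fin 3) (Fin 3) ℝ, IsBddBelow 2 W ∧ gridCode W = c then h.choose⁻¹ else 0

theorem gridInverse_posSemidef (c : Fin 3 → Fin 3 → ℤ) : (gridInverse c).PosSemidef := by
  rw [gridInverse]
  split_ifs with h
  · exact (h.choose_spec.1.posDef two_pos).inv.posSemidef
  · exact Matrix.PosSemidef.zero

theorem abs_sub_le_of_gridCode_eq {V W : Matrix (Fin 3) (Fin 3) ℝ} (h : gridCode V = gridCode W)
    (i j : Fin 3) : |V i j - W i j| ≤ 1 / 40 := by
  have h1 : ⌊40 * V i j⌋ = ⌊40 * W i j⌋ := congrFun (congrFun h i) j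
  have h2 := Int.abs_sub_lt_one_of_floor_eq_floor h1
  rw [← mul_sub, abs_mul, abs_of_pos (by norm_num : (0 : ℝ) < 40)] at h2
  linarith

/-- Entries agreeing up to `1/40` make two matrices above `2` comparable within the factor `1 + 3/80
= 83/80`, in both directions. The trace is then at most `3 · 83/80 < 16/5`, the budget. -/
theorem gridInverse_spec {V : Matrix (Fin 3) (Fin 3) ℝ} (hV : IsBddBelow 2 V) :
    (gridInverse (gridCode V) * V).trace ≤ 16 / 5 ∧
      ∀ x, x ⬝ᵥ (V⁻¹ *ᵥ x) ≤ 83 / 80 * (x ⬝ᵥ (gridInverse (gridCode V) *ᵥ x)) := by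
  have h : ∃ W : Matrix (Fin 3) (Fin 3) ℝ, IsBddBelow 2 W ∧ gridCode W = gridCode V :=
    ⟨V, hV, rfl⟩
  rw [gridInverse, dif_pos h]
  obtain ⟨hW, hcode⟩ := h.choose_spec
  set W := h.choose
  have hVp := hV.posDef two_pos
  have hWp := hW.posDef two_pos
  constructor
  · have := trace_inv_mul_le hV.symm hWp
      (form_le_of_entries_close (by norm_num) hW (abs_sub_le_of_gridCode_eq hcode.symm))
    norm_num at this
    linarith
  · intro x
    have := form_inv_le hVp hWp
      (form_le_of_entries_close (by norm_num) hV (abs_sub_le_of_gridCode_eq hcode)) x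
    norm_num at this
    exact this

/-- The codes with entries bounded by `M`. -/
noncomputable def codeBox (M : ℕ) : Finset (Fin 3 → Fin 3 → ℤ) :=
  Fintype.piFinset fun _ => Fintype.piFinset fun _ => Finset.Icc (-(M : ℤ)) M

theorem card_codeBox (M : ℕ) : (codeBox M).card = (2 * M + 1) ^ 9 := by
  have h : ((M : ℤ) + 1 - -(M : ℤ)).toNat = 2 * M + 1 := by omega
  simp only [codeBox, Fintype.card_piFinset, Int.card_Icc, h, Finset.prod_const, Finset.card_univ,
    Fintype.card_fin]
  ring

theorem gridCode_mem_codeBox {V : Matrix (Fin 3) (Fin 3) ℝ} {M : ℕ}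
    (h : ∀ i j, 40 * |V i j| ≤ M) : gridCode V ∈ codeBox M := by
  refine Fintype.mem_piFinset.mpr fun i => Fintype.mem_piFinset.mpr fun j => ?_
  have h1 := h i j
  rw [Finset.mem_Icc, gridCode, Int.le_floor]
  obtain ⟨h2, h3⟩ := abs_le.mp (le_refl |V i j|)
  refine ⟨by push_cast; linarith, Int.floor_le_iff.mpr ?_⟩
  push_cast
  linarith

/-! ### The failure probability -/

/-- Good estimates in all earlier batches validate their weights, and the budget is controlled by
the trace of the representative's inverse times the design matrix. -/
theorem withinBudget_of_good (hθ : θ ⬝ᵥ θ = 1) {X : ℕ → ℝ} {s : ℕ}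
    (hgood : ∀ r < s, 1 ≤ r → Good tb init θ k X r) :
    WithinBudget θ (roundAction tb k init) (roundWeight tb k init) (roundSubsample hk)
      (gridInverse (gridCode (stateAt tb k init X s).design)) X (s * batchLength 3 k) := by
  refine ⟨fun t ht => ?_, fun j => ?_⟩
  · have hlt : t / batchLength 3 k < s := Nat.div_lt_of_lt_mul (by rwa [mul_comm])
    rw [roundWeight, batchWeight, roundAction_eq]
    split_ifs with h0
    -- The first batch has weight `1` and needs no estimate: the variance is at most `1`.
    · nlinarith [sq_nonneg (θ ⬝ᵥ nextAction tb (stateAt tb k init X (t / batchLength 3 k))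
        (actionIndex (by norm_num) k t) (decide (t % 2 = 0)))]
    · exact weight_mul_variance_le tb (designBounds_stateAt tb k init X _) hθ
        (hgood _ hlt (Nat.one_le_iff_ne_zero.mpr h0)) _ _
  · exact (budget_le_trace tb hk init (gridInverse_posSemidef _) X s j).trans
      (gridInverse_spec (designBounds_stateAt tb k init X s).bddBelow).1

theorem three_pow_le_potential (hθ : θ ⬝ᵥ θ = 1) {X : ℕ → ℝ} {s : ℕ} (hs : 1 ≤ s)
    (hgood : ∀ r < s, 1 ≤ r → Good tb init θ k X r) (hbad : ¬ Good tb init θ k X s) :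
    (3 : ℝ) ^ (k - 1) ≤ potential θ (roundAction tb k init) (roundWeight tb k init)
      (roundSubsample hk) (gridInverse (gridCode (stateAt tb k init X s).design)) X
      (s * batchLength 3 k) := by
  obtain ⟨s, rfl⟩ := Nat.exists_eq_add_of_le' hs
  have hcard := card_noisy_of_not_good tb hk init hθ X s hbad
  have h9 := le_potential_of_card (gridInverse_posSemidef _)
    (withinBudget_of_good tb hk init hθ hgood) _ hcard (fun j hj => by
      have h1 := (Finset.mem_filter.mp hj).2
      have h2 := (gridInverse_spec (designBounds_stateAt tb k init X (s + 1)).bddBelow).2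
        (batchNoise tb hk init θ X (s + 1) j)
      rw [batchNoise] at h1 h2
      linarith)
  refine le_trans ?_ h9
  have : (9 : ℝ) = 3 ^ 2 := by norm_num
  rw [this, ← pow_mul]
  exact pow_le_pow_right₀ (by norm_num) (by omega)

theorem potential_congr {d : ℕ} {θ : Fin d → ℝ} {A : ℕ → (ℕ → ℝ) → Fin d → ℝ}
    {w : ℕ → (ℕ → ℝ) → ℝ} {σ : ℕ → Fin k} {P : Matrix (Fin d) (Fin d) ℝ}
    (hA : Predictable A) (hw : Predictable w) {X X' : ℕ → ℝ} {n : ℕ} (h : ∀ s < n, X s = X' s) :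
    potential θ A w σ P X n = potential θ A w σ P X' n := by
  have hb : ∀ j, budget A w σ P X n j = budget A w σ P X' n j := fun j =>
    budget_congr hA hw (fun s hs _ => h s hs) j
  have hW : WithinBudget θ A w σ P X n ↔ WithinBudget θ A w σ P X' n := by
    refine and_congr (forall₂_congr fun t ht => ?_) (forall_congr' fun j => by rw [hb])
    have hlt : ∀ s < t, X s = X' s := fun s hs => h s (hs.trans ht)
    rw [hA t X X' hlt, hw t X X' hlt]
  rw [potential, potential]
  by_cases hX : WithinBudget θ A w σ P X n
  · rw [if_pos hX, if_pos (hW.mp hX)]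
    simp only [potentialFactor, noiseSum_congr hA hw h, hb]
  · rw [if_neg hX, if_neg (hW.not.mp hX)]

theorem rescaled_firstRewards {n T : ℕ} (x : Fin T → Bool) (hn : n ≤ T) {t : ℕ} (ht : t < n) :
    rescaled (firstRewards x n hn) t = rescaled x t := by
  rw [rescaled, rescaled, dif_pos ht, dif_pos (ht.trans_le hn)]
  rfl

/-- Some completed batch among the first `T` rounds has a bad estimate. -/
def Failure (θ : Fin 3 → ℝ) (k T : ℕ) (X : ℕ → ℝ) : Prop :=
  ∃ s, 1 ≤ s ∧ s * batchLength 3 k ≤ T ∧ ¬ Good tb init θ k X s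

theorem qubitPolicy_eq (n : ℕ) (h : Fin n → Bool) :
    qubitPolicy tb k init n h = blochProj (roundAction tb k init n (rescaled h)) := rfl

-- Union bound over the first bad batch and the code of its design matrix, with Markov's inequality
-- for each pair. Taking the first bad batch is what guarantees valid weights up to that time.
open Classical in
theorem expect_failure_le (hk : 0 < k) (hθ : θ ⬝ᵥ θ = 1) {N T : ℕ} (hT : T ≤ N * batchLength 3 k) :
    expect (blochProj θ) (qubitPolicy tb k init)
        (fun x : Fin T → Bool => if Failure tb init θ k T (rescaled x) then (1 : ℝ) else 0) ≤
      N * (2 * (40 * (3 + N) ^ 2) + 1) ^ 9 * ((9 / 5) ^ k / 3 ^ (k - 1)) := by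
  set K := batchLength 3 k with hK
  have hK0 : 0 < K := by rw [hK, batchLength_three]; omega
  set M := 40 * (3 + N) ^ 2 with hM
  set I := (Finset.Icc 1 N).filter fun s => s * K ≤ T with hI
  set Φ : ℕ → (Fin 3 → Fin 3 → ℤ) → (ℕ → ℝ) → ℝ := fun s c X =>
    potential θ (roundAction tb k init) (roundWeight tb k init) (roundSubsample hk)
      (gridInverse c) X (s * K) with hΦ
  have hΦ0 : ∀ s c X, 0 ≤ Φ s c X := fun s c X => potential_nonneg (gridInverse_posSemidef c) X _
  have hπ : ∀ (n : ℕ) (h : Fin n → Bool) (b : Bool),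
      0 ≤ rewardProb (blochProj θ) (qubitPolicy tb k init n h) b := fun n h b =>
    rewardProb_blochProj_nonneg hθ (roundAction_dotProduct_self tb k init _ _) b
  have h1 : ∀ x : Fin T → Bool, (if Failure tb init θ k T (rescaled x) then (1 : ℝ) else 0) ≤
      ∑ s ∈ I, ∑ c ∈ codeBox M, (3 ^ (k - 1))⁻¹ * Φ s c (rescaled x) := by
    intro x
    have hnn : ∀ s ∈ I, 0 ≤ ∑ c ∈ codeBox M, (3 ^ (k - 1))⁻¹ * Φ s c (rescaled x) := fun s _ =>
      Finset.sum_nonneg fun c _ => mul_nonneg (by positivity) (hΦ0 _ _ _)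
    split_ifs with hfail
    · have hex : ∃ s, 1 ≤ s ∧ s * K ≤ T ∧ ¬ Good tb init θ k (rescaled x) s := hfail
      obtain ⟨hs1, hsT, hsbad⟩ := Nat.find_spec hex
      set s := Nat.find hex with hs
      have hmin : ∀ r < s, 1 ≤ r → Good tb init θ k (rescaled x) r := fun r hr hr1 => by
        by_contra hb
        exact Nat.find_min hex hr ⟨hr1, (Nat.mul_le_mul_right K hr.le).trans hsT, hb⟩
      have hsN : s ≤ N := Nat.le_of_mul_le_mul_right (hsT.trans hT) hK0
      have hsI : s ∈ I := Finset.mem_filter.mpr ⟨Finset.mem_Icc.mpr ⟨hs1, hsN⟩, hsT⟩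
      have hD := designBounds_stateAt tb k init (rescaled x) s
      have hc : gridCode (stateAt tb k init (rescaled x) s).design ∈ codeBox M := by
        refine gridCode_mem_codeBox fun i j => ?_
        have e1 := abs_entry_le_lamMax zero_le_two hD.bddBelow i j
        have e2 := hD.lamMax_le
        have e3 : ((s : ℝ)) ≤ N := by exact_mod_cast hsN
        have e4 : (3 + (s : ℝ)) ^ 2 ≤ (3 + N) ^ 2 := by gcongr
        rw [hM]
        push_cast
        linarith
      have hpot := three_pow_le_potential tb hk init hθ hs1 hmin hsbad
      calc (1 : ℝ) = (3 ^ (k - 1))⁻¹ * 3 ^ (k - 1) := by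
            rw [inv_mul_cancel₀ (by positivity)]
        _ ≤ (3 ^ (k - 1))⁻¹ *
            Φ s (gridCode (stateAt tb k init (rescaled x) s).design) (rescaled x) := by
            gcongr
        _ ≤ ∑ c ∈ codeBox M, (3 ^ (k - 1))⁻¹ * Φ s c (rescaled x) :=
            Finset.single_le_sum (f := fun c => (3 ^ (k - 1))⁻¹ * Φ s c (rescaled x))
              (fun c _ => mul_nonneg (by positivity) (hΦ0 _ _ _)) hc
        _ ≤ _ := Finset.single_le_sum
              (f := fun s => ∑ c ∈ codeBox M, (3 ^ (k - 1))⁻¹ * Φ s c (rescaled x)) hnn hsI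
    · exact Finset.sum_nonneg hnn
  have h2 : ∀ s ∈ I, ∀ c, expect (blochProj θ) (qubitPolicy tb k init)
      (fun x : Fin T → Bool => Φ s c (rescaled x)) ≤ (9 / 5) ^ k := by
    intro s hs c
    have hsT := (Finset.mem_filter.mp hs).2
    have hA := predictable_roundAction tb k init
    have hw := predictable_roundWeight tb k init
    set g : (Fin (s * K) → Bool) → ℝ := fun h => Φ s c (rescaled h) with hg
    have he : (fun x : Fin T → Bool => Φ s c (rescaled x)) =
        fun x => g (firstRewards x (s * K) hsT) := by
      funext x
      exact potential_congr hA hw fun t ht => (rescaled_firstRewards x hsT ht).symm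
    rw [he, expect_firstRewards hsT g]
    exact expect_potential_le (gridInverse_posSemidef c) hA hw
      (fun t X => batchWeight_nonneg tb k init X _) (qubitPolicy_eq tb init) hθ
      (roundAction_dotProduct_self tb k init) _
  refine (expect_mono hπ h1).trans ?_
  rw [expect_sum]
  simp only [expect_sum, expect_const_mul]
  calc _ ≤ ∑ s ∈ I, ∑ c ∈ codeBox M, ((3 : ℝ) ^ (k - 1))⁻¹ * (9 / 5) ^ k :=
        Finset.sum_le_sum fun s hs => Finset.sum_le_sum fun c _ =>
          mul_le_mul_of_nonneg_left (h2 s hs c) (by positivity)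
    _ = I.card * ((2 * M + 1) ^ 9 * (((3 : ℝ) ^ (k - 1))⁻¹ * (9 / 5) ^ k)) := by
        rw [Finset.sum_const, Finset.sum_const, card_codeBox, nsmul_eq_mul, nsmul_eq_mul]
        push_cast
        ring
    _ ≤ N * ((2 * M + 1) ^ 9 * (((3 : ℝ) ^ (k - 1))⁻¹ * (9 / 5) ^ k)) := by
        have : I.card ≤ N := by simpa using Finset.card_filter_le (Finset.Icc 1 N) (· * K ≤ T)
        gcongr
    _ = _ := by rw [hM]; push_cast; ring

end Concentration

/-! ### Regret and infidelity -/

section Main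

variable (tb : TieBreak 3) (init : Fin 3 → ℝ)

/-- The constant in the `O(1 / s)` infidelity of the batch `s`. -/
noncomputable def infidelityConst : ℝ := 15 * betaW 3 2 / (4 * weightConst)

/-- The constant in the `O(1 / N)` failure probability. -/
noncomputable def failureConst : ℝ := 3 * 1000 ^ 9

theorem one_le_infidelityConst : 1 ≤ infidelityConst := by
  have h1 := hundred_le_betaW
  have h2 := weightConst_pos
  have h3 := weightConst_le
  rw [infidelityConst, le_div_iff₀ (by positivity)]
  linarith

theorem failure_bound_le {N k : ℕ} (hN : 2 ≤ N) (hk0 : 0 < k) (hk : 48 * Real.log N ≤ k) :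
    (N : ℝ) * (2 * (40 * (3 + N) ^ 2) + 1) ^ 9 * ((9 / 5) ^ k / 3 ^ (k - 1)) ≤
      failureConst / N := by
  have hN' : (2 : ℝ) ≤ N := by exact_mod_cast hN
  have hN0 : (0 : ℝ) < N := by linarith
  have h1 : (2 * (40 * (3 + (N : ℝ)) ^ 2) + 1) ≤ 1000 * N ^ 2 := by nlinarith
  have h2 : ((9 : ℝ) / 5) ^ k / 3 ^ (k - 1) = 3 * (3 / 5) ^ k := by
    obtain ⟨m, rfl⟩ := Nat.exists_eq_add_of_le' hk0
    have h3 : ((9 : ℝ) / 5) = 3 * (3 / 5) := by norm_num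
    rw [Nat.add_sub_cancel, h3, mul_pow, pow_succ (3 : ℝ)]
    field_simp
  -- With `k ≥ 48 log N` this yields `(3/5) ^ k ≤ N⁻²⁴`, against the factor of order `N¹⁹` from the
  -- union bound.
  have h3 : ((3 : ℝ) / 5) ≤ Real.exp (-(1 / 2)) := by
    have h4 : Real.exp (1 / 2) ≤ 5 / 3 := by
      have h5 : Real.exp (1 / 2) ^ 2 = Real.exp 1 := by
        rw [← Real.exp_nat_mul]; norm_num
      have h6 := Real.exp_one_lt_d9
      refine le_of_sq_le_sq ?_ (by norm_num)
      rw [h5]; linarith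
    rw [Real.exp_neg]
    calc (3 / 5 : ℝ) = (5 / 3)⁻¹ := by norm_num
      _ ≤ _ := inv_anti₀ (Real.exp_pos _) h4
  have h4 : ((3 : ℝ) / 5) ^ k ≤ ((N : ℝ) ^ 24)⁻¹ := by
    calc ((3 : ℝ) / 5) ^ k ≤ Real.exp (-(1 / 2)) ^ k := pow_le_pow_left₀ (by norm_num) h3 k
      _ = Real.exp (-(k / 2)) := by rw [← Real.exp_nat_mul]; congr 1; ring
      _ ≤ Real.exp (-((24 : ℕ) * Real.log N)) := by
          apply Real.exp_le_exp.mpr; push_cast; linarith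
      _ = _ := by rw [Real.exp_neg, Real.exp_nat_mul, Real.exp_log hN0]
  rw [h2]
  calc (N : ℝ) * (2 * (40 * (3 + N) ^ 2) + 1) ^ 9 * (3 * (3 / 5) ^ k)
      ≤ N * (1000 * N ^ 2) ^ 9 * (3 * ((N : ℝ) ^ 24)⁻¹) := by gcongr
    _ = failureConst / N * ((N : ℝ) ^ 4)⁻¹ := by
        rw [failureConst]; field_simp
    _ ≤ failureConst / N := by
        refine mul_le_of_le_one_right (by rw [failureConst]; positivity) ?_
        exact inv_le_one_of_one_le₀ (one_le_pow₀ (by linarith))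

-- Off the failure event, accuracy under a good estimate combines with the linear growth of `λ_min`.
-- On it, and in the first batch, the trivial bound `1` is enough.
open Classical in
theorem infidelity_nextAction_le {θ : Fin 3 → ℝ} (hθ : θ ⬝ᵥ θ = 1) (k T : ℕ) (X : ℕ → ℝ) (s : ℕ)
    (hs : s * batchLength 3 k ≤ T) (i : Fin (3 - 1)) (sgn : Bool) :
    (1 - θ ⬝ᵥ nextAction tb (stateAt tb k init X s) i sgn) / 2 ≤
      infidelityConst / (s + 1) + if Failure tb init θ k T X then (1 : ℝ) else 0 := by
  have hD := designBounds_stateAt tb k init X s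
  have hc := one_le_infidelityConst
  have h1 := (dotProduct_mem_Icc hθ (nextAction_dotProduct_self tb hD.bddBelow i sgn)).1
  have hpos : 0 ≤ infidelityConst / ((s : ℝ) + 1) := by positivity
  split_ifs with hF
  · linarith
  rw [add_zero]
  rcases Nat.eq_zero_or_pos s with rfl | hs0
  · norm_num
    linarith
  · have hgood : Good tb init θ k X s := by
      by_contra hb
      exact hF ⟨s, hs0, hs, hb⟩
    have h2 := one_sub_dotProduct_nextAction_le tb hD.bddBelow hθ hgood i sgn
    have h3 := hD.le_lamMin
    have hC := weightConst_pos
    have hβ := hundred_le_betaW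
    have h4 : 5 * betaW 3 2 / lamMin (stateAt tb k init X s).design ≤
        5 * betaW 3 2 / (weightConst / 3 * (s + 1)) := by gcongr
    have h5 : 5 * betaW 3 2 / (weightConst / 3 * (s + 1)) = 4 * (infidelityConst / (s + 1)) := by
      rw [infidelityConst]; field_simp; ring
    linarith

theorem log_natCast_sq (N : ℕ) : Real.log ((N : ℝ) ^ 2) = 2 * Real.log N := by
  rw [Real.log_pow]; norm_num

theorem horizon_le (N : ℕ) : horizon N ≤ N * batchLength 3 (subsamples N) := by
  rw [horizon, Nat.ceil_le, batchLength_three, subsamples]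
  have h := Nat.le_ceil (24 * Real.log ((N : ℝ) ^ 2))
  push_cast
  have := mul_le_mul_of_nonneg_left h (Nat.cast_nonneg (α := ℝ) N)
  linarith

theorem horizon_eq_zero {N : ℕ} (hN : N < 2) : horizon N = 0 := by
  interval_cases N <;> simp [horizon]

theorem log_two_le {N : ℕ} (hN : 2 ≤ N) : 1 / 2 ≤ Real.log N := by
  have h1 : Real.log 2 ≤ Real.log N :=
    Real.log_le_log two_pos (by exact_mod_cast hN)
  linarith [Real.log_two_gt_d9]

theorem le_horizon {N : ℕ} (hN : 2 ≤ N) : N ≤ horizon N := by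
  have h := Nat.le_ceil (96 * (N : ℝ) * Real.log ((N : ℝ) ^ 2))
  rw [← horizon, log_natCast_sq] at h
  have h1 := log_two_le hN
  have h2 : (0 : ℝ) ≤ N := Nat.cast_nonneg N
  have : (N : ℝ) ≤ horizon N := by nlinarith
  exact_mod_cast this

theorem subsamples_bounds {N : ℕ} (hN : 2 ≤ N) :
    48 * Real.log N ≤ subsamples N ∧ (subsamples N : ℝ) ≤ 50 * Real.log (horizon N) := by
  have h1 := log_two_le hN
  have h2 := Nat.le_ceil (24 * Real.log ((N : ℝ) ^ 2))
  have h3 := Nat.ceil_lt_add_one (a := 24 * Real.log ((N : ℝ) ^ 2)) (by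
    rw [log_natCast_sq]; linarith)
  rw [← subsamples, log_natCast_sq] at h2 h3
  have h4 : Real.log N ≤ Real.log (horizon N) :=
    Real.log_le_log (by positivity) (by exact_mod_cast le_horizon hN)
  constructor <;> linarith

open Classical in
theorem expect_failure_horizon_le {θ : Fin 3 → ℝ} (hθ : θ ⬝ᵥ θ = 1) {N : ℕ} (hN : 2 ≤ N) :
    expect (blochProj θ) (qubitPolicy tb (subsamples N) init) (fun x : Fin (horizon N) → Bool =>
        if Failure tb init θ (subsamples N) (horizon N) (rescaled x) then (1 : ℝ) else 0) ≤
      failureConst / N := by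
  have h1 := (subsamples_bounds hN).1
  have hk : 0 < subsamples N := by
    have := log_two_le hN
    have : (0 : ℝ) < subsamples N := by linarith
    exact_mod_cast this
  exact (expect_failure_le tb init hk hθ (horizon_le N)).trans (failure_bound_le hN hk h1)

theorem inv_div_add_one_le {K : ℕ} (hK : 0 < K) (t : ℕ) :
    1 / (((t / K : ℕ) : ℝ) + 1) ≤ K / (t + 1) := by
  rw [div_le_div_iff₀ (by positivity) (by positivity)]
  have h : t + 1 ≤ K * (t / K + 1) := Nat.lt_mul_div_succ t hK
  have h' : ((t : ℝ) + 1) ≤ K * (((t / K : ℕ) : ℝ) + 1) := by exact_mod_cast h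
  linarith

theorem sum_one_div_add_one_le (T : ℕ) :
    ∑ t ∈ Finset.range T, 1 / ((t : ℝ) + 1) ≤ 1 + Real.log T := by
  have h := harmonic_le_one_add_log T
  rw [harmonic] at h
  push_cast at h
  simpa [one_div] using h

-- Round `t` lies in batch `t / K` with `K = 4k`, so the infidelities sum to `K` times a harmonic
-- sum. Failure costs at most `T` with probability `O(1 / N)`, and `T ≤ 4kN`.
open Classical in
theorem expect_regret_le {θ : Fin 3 → ℝ} (hθ : θ ⬝ᵥ θ = 1) {N : ℕ} (hN : 2 ≤ N) :
    expect (blochProj θ) (qubitPolicy tb (subsamples N) init)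
        (fun x : Fin (horizon N) → Bool =>
          regret (blochProj θ) (qubitPolicy tb (subsamples N) init) x) ≤
      200 * (infidelityConst + failureConst) * Real.log (horizon N) +
        200 * infidelityConst * Real.log (horizon N) ^ 2 := by
  set T := horizon N with hTdef
  set k := subsamples N with hkdef
  set L := Real.log T
  obtain ⟨hk1, hk2⟩ := subsamples_bounds hN
  have hlog := log_two_le hN
  have hN0 : (0 : ℝ) < N := by positivity
  have hk : 0 < k := by
    have : (0 : ℝ) < k := by linarith
    exact_mod_cast this
  have hK : 0 < batchLength 3 k := by rw [batchLength_three]; omega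
  have hc := one_le_infidelityConst
  have hcF : 0 ≤ failureConst := by rw [failureConst]; positivity
  have hπ : ∀ (n : ℕ) (h : Fin n → Bool) (b : Bool),
      0 ≤ rewardProb (blochProj θ) (qubitPolicy tb k init n h) b := fun n h b =>
    rewardProb_blochProj_nonneg hθ (roundAction_dotProduct_self tb k init _ _) b
  have hpt : ∀ x : Fin T → Bool, regret (blochProj θ) (qubitPolicy tb k init) x ≤
      infidelityConst * (batchLength 3 k * (1 + L)) +
        T * if Failure tb init θ k T (rescaled x) then (1 : ℝ) else 0 := by
    intro x
    have hround : ∀ t : Fin T, sSup (overlap (blochProj θ) '' pureStates 2) -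
        overlap (blochProj θ) (actionAt (qubitPolicy tb k init) x t) ≤
        infidelityConst * (batchLength 3 k * (1 / ((t : ℕ) + 1))) +
          if Failure tb init θ k T (rescaled x) then (1 : ℝ) else 0 := by
      intro t
      have hact : actionAt (qubitPolicy tb k init) x t =
          blochProj (roundAction tb k init t (rescaled x)) := by
        rw [actionAt, qubitPolicy_eq]
        congr 1
        exact predictable_roundAction tb k init _ _ _ fun s hs =>
          rescaled_firstRewards x t.2.le hs
      have h1 := infidelity_nextAction_le tb init hθ k T (rescaled x) (t / batchLength 3 k)
        ((Nat.div_mul_le_self _ _).trans t.2.le) (actionIndex (by norm_num) k t)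
        (decide ((t : ℕ) % 2 = 0))
      rw [← roundAction_eq] at h1
      rw [hact, overlap_blochProj]
      have h2 := mul_le_mul_of_nonneg_left (inv_div_add_one_le hK t)
        (zero_le_one.trans hc)
      have h3 := sSup_overlap_le hθ
      rw [mul_one_div, div_eq_mul_one_div (batchLength 3 k : ℝ)] at h2
      linarith
    calc regret (blochProj θ) (qubitPolicy tb k init) x ≤ ∑ t : Fin T,
          (infidelityConst * (batchLength 3 k * (1 / ((t : ℕ) + 1))) +
            if Failure tb init θ k T (rescaled x) then (1 : ℝ) else 0) :=
          Finset.sum_le_sum fun t _ => hround t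
      _ = infidelityConst * (batchLength 3 k * ∑ t ∈ Finset.range T, 1 / ((t : ℝ) + 1)) +
          T * if Failure tb init θ k T (rescaled x) then (1 : ℝ) else 0 := by
          rw [Finset.sum_add_distrib, ← Finset.mul_sum, ← Finset.mul_sum,
            Fin.sum_univ_eq_sum_range (fun t => 1 / ((t : ℝ) + 1)), Finset.sum_const,
            Finset.card_univ, Fintype.card_fin, nsmul_eq_mul]
      _ ≤ _ := by
          gcongr
          exact sum_one_div_add_one_le T
  refine (expect_mono hπ hpt).trans ?_
  rw [expect_add, expect_const, expect_const_mul]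
  have hfail := expect_failure_horizon_le tb init hθ hN
  have hTK : (T : ℝ) ≤ N * (4 * k) := by
    have := horizon_le N
    rw [batchLength_three] at this
    exact_mod_cast this
  have hT2 : (T : ℝ) * (failureConst / N) ≤ 4 * k * failureConst := by
    calc (T : ℝ) * (failureConst / N) ≤ N * (4 * k) * (failureConst / N) := by gcongr
      _ = _ := by field_simp
  have hL : 0 ≤ L := by
    have : (0 : ℝ) ≤ k := Nat.cast_nonneg k
    linarith
  have hT3 := mul_le_mul_of_nonneg_left hfail (Nat.cast_nonneg (α := ℝ) T)
  -- From `k ≤ 50 log T`; this is the origin of the factor `200`.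
  have hkL : 4 * (k : ℝ) ≤ 200 * L := by linarith
  have h4 : infidelityConst * (batchLength 3 k * (1 + L)) ≤
      infidelityConst * (200 * L * (1 + L)) := by
    rw [batchLength_three]
    push_cast
    gcongr
  have h5 : 4 * (k : ℝ) * failureConst ≤ 200 * L * failureConst := by
    gcongr
  linarith

-- The failure probability `O(1 / N)` is itself `O(k / t)`, because `t ≤ 4kN`.
open Classical in
theorem expect_infidelity_le {θ : Fin 3 → ℝ} (hθ : θ ⬝ᵥ θ = 1) {N : ℕ} (hN : 2 ≤ N)
    (i : Fin 2) (sgn : Bool) (t : ℕ) (ht1 : 1 ≤ t) (ht : t ≤ horizon N) :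
    expect (blochProj θ) (qubitPolicy tb (subsamples N) init)
        (fun x : Fin (horizon N) → Bool => 1 - overlap (blochProj θ)
          (qubitEstimator tb (subsamples N) init i sgn t (firstRewards x t ht))) ≤
      200 * (infidelityConst + failureConst) * Real.log (horizon N) / t := by
  set T := horizon N with hTdef
  set k := subsamples N with hkdef
  obtain ⟨hk1, hk2⟩ := subsamples_bounds hN
  have hlog := log_two_le hN
  have hN0 : (0 : ℝ) < N := by positivity
  have ht0 : (0 : ℝ) < t := by exact_mod_cast ht1
  have hk : 0 < k := by
    have : (0 : ℝ) < k := by linarith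
    exact_mod_cast this
  have hK : 0 < batchLength 3 k := by rw [batchLength_three]; omega
  have hc := one_le_infidelityConst
  have hcF : 0 ≤ failureConst := by rw [failureConst]; positivity
  have hπ : ∀ (n : ℕ) (h : Fin n → Bool) (b : Bool),
      0 ≤ rewardProb (blochProj θ) (qubitPolicy tb k init n h) b := fun n h b =>
    rewardProb_blochProj_nonneg hθ (roundAction_dotProduct_self tb k init _ _) b
  have hpt : ∀ x : Fin T → Bool, 1 - overlap (blochProj θ)
      (qubitEstimator tb k init i sgn t (firstRewards x t ht)) ≤
      infidelityConst * (batchLength 3 k / t) +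
        if Failure tb init θ k T (rescaled x) then (1 : ℝ) else 0 := by
    intro x
    have hle : (t - 1) / batchLength 3 k * batchLength 3 k ≤ t - 1 := Nat.div_mul_le_self _ _
    have hst : stateAt tb k init (rescaled (firstRewards x t ht)) ((t - 1) / batchLength 3 k) =
        stateAt tb k init (rescaled x) ((t - 1) / batchLength 3 k) :=
      -- The batch containing step `t` starts after at most `t - 1` rounds, so truncating the
      -- rewards at `t` does not affect its actions.
      stateAt_congr tb k init fun s hs => rescaled_firstRewards x ht (by omega)
    have h1 := infidelity_nextAction_le tb init hθ k T (rescaled x) ((t - 1) / batchLength 3 k)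
      (by omega) i sgn
    have h2 := mul_le_mul_of_nonneg_left (inv_div_add_one_le hK (t - 1)) (zero_le_one.trans hc)
    rw [← hst] at h1
    rw [mul_one_div, Nat.cast_pred ht1, sub_add_cancel] at h2
    have h3 : qubitEstimator tb k init i sgn t (firstRewards x t ht) = blochProj (nextAction tb
        (stateAt tb k init (rescaled (firstRewards x t ht)) ((t - 1) / batchLength 3 k)) i sgn) :=
      rfl
    rw [h3, overlap_blochProj]
    linarith
  refine (expect_mono hπ hpt).trans ?_
  rw [expect_add, expect_const]
  have hfail := expect_failure_horizon_le tb init hθ hN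
  have htK : (t : ℝ) ≤ N * (4 * k) := by
    have h := ht.trans (horizon_le N)
    rw [batchLength_three] at h
    exact_mod_cast h
  have h1 : failureConst / N ≤ failureConst * (4 * k / t) := by
    rw [div_eq_mul_one_div]
    refine mul_le_mul_of_nonneg_left ?_ hcF
    rw [div_le_div_iff₀ hN0 ht0]
    linarith
  have h2 : (infidelityConst + failureConst) * (4 * k / t) ≤
      (infidelityConst + failureConst) * (200 * Real.log T / t) := by
    have hkL : 4 * (k : ℝ) ≤ 200 * Real.log T := by linarith
    gcongr
  rw [batchLength_three]
  push_cast
  calc _ ≤ infidelityConst * (4 * k / t) + failureConst * (4 * k / t) := by linarith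
    _ = (infidelityConst + failureConst) * (4 * k / t) := by ring
    _ ≤ _ := h2
    _ = _ := by ring

end Main

end PSMAQB

theorem mainTheorem1 :
    ∃ C₁ C₂ C₃ : ℝ, 0 ≤ C₁ ∧ 0 ≤ C₂ ∧ 0 ≤ C₃ ∧
      ∀ (N : ℕ) (tb : PSMAQB.TieBreak 3) (init : Fin 3 → ℝ), init ⬝ᵥ init = 1 →
        -- the actions of the algorithm are rank-one projectors
        (∀ (x : Fin (PSMAQB.horizon N) → Bool) (t : Fin (PSMAQB.horizon N)),
          PSMAQB.actionAt (PSMAQB.qubitPolicy tb (PSMAQB.subsamples N) init) x t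
            ∈ PSMAQB.pureStates 2) ∧
        -- so are the estimators
        (∀ (i : Fin 2) (sgn : Bool) (t : ℕ) (h : Fin t → Bool),
          1 ≤ t → t ≤ PSMAQB.horizon N →
          PSMAQB.qubitEstimator tb (PSMAQB.subsamples N) init i sgn t h ∈ PSMAQB.pureStates 2) ∧
        ∀ ρ ∈ PSMAQB.pureStates 2,
          -- expected regret
          PSMAQB.expect ρ (PSMAQB.qubitPolicy tb (PSMAQB.subsamples N) init)
              (fun x : Fin (PSMAQB.horizon N) → Bool =>
                PSMAQB.regret ρ (PSMAQB.qubitPolicy tb (PSMAQB.subsamples N) init) x)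
            ≤ C₁ * Real.log (PSMAQB.horizon N) + C₂ * Real.log (PSMAQB.horizon N) ^ 2 ∧
          -- expected infidelity of the estimator
          ∀ (i : Fin 2) (sgn : Bool) (t : ℕ), 1 ≤ t → ∀ ht : t ≤ PSMAQB.horizon N,
            PSMAQB.expect ρ (PSMAQB.qubitPolicy tb (PSMAQB.subsamples N) init)
                (fun x : Fin (PSMAQB.horizon N) → Bool =>
                  1 - PSMAQB.overlap ρ
                    (PSMAQB.qubitEstimator tb (PSMAQB.subsamples N) init i sgn t
                      (PSMAQB.firstRewards x t ht)))
              ≤ C₃ * Real.log (PSMAQB.horizon N) / t := by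
  have hc := PSMAQB.one_le_infidelityConst
  have hcF : 0 ≤ PSMAQB.failureConst := by rw [PSMAQB.failureConst]; positivity
  refine ⟨200 * (PSMAQB.infidelityConst + PSMAQB.failureConst), 200 * PSMAQB.infidelityConst,
    200 * (PSMAQB.infidelityConst + PSMAQB.failureConst), by positivity, by positivity,
    by positivity, fun N tb init _ => ⟨fun x t => ?_, fun i sgn t h _ _ => ?_, fun ρ hρ => ?_⟩⟩
  · exact PSMAQB.blochProj_mem_pureStates (PSMAQB.roundAction_dotProduct_self tb _ init _ _)
  · exact PSMAQB.blochProj_mem_pureStates (PSMAQB.nextAction_dotProduct_self tb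
      (PSMAQB.designBounds_stateAt tb _ init _ _).bddBelow i sgn)
  obtain ⟨θ, hθ, rfl⟩ := PSMAQB.exists_blochProj_of_mem_pureStates hρ
  rcases lt_or_ge N 2 with hN | hN
  · have h0 := PSMAQB.horizon_eq_zero hN
    refine ⟨?_, fun i sgn t ht1 ht => by omega⟩
    have hr : (fun x : Fin (PSMAQB.horizon N) → Bool => PSMAQB.regret (PSMAQB.blochProj θ)
        (PSMAQB.qubitPolicy tb (PSMAQB.subsamples N) init) x) = fun _ => 0 := by
      funext x
      have : IsEmpty (Fin (PSMAQB.horizon N)) := by rw [h0]; infer_instance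
      rw [PSMAQB.regret, Finset.univ_eq_empty, Finset.sum_empty]
    rw [hr, PSMAQB.expect_const, h0]
    simp
  · exact ⟨PSMAQB.expect_regret_le tb init hθ hN, fun i sgn t ht1 ht =>
      PSMAQB.expect_infidelity_le tb init hθ hN i sgn t ht1 ht⟩
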